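/- Let $k$ be a field, let $G$ be a finite simple graph with vertex set $V(G)=\{x_1,\dots,x_n\}$, and let $S=k[x_1,\dots,x_n]$ be the standard graded polynomial ring whose variables are the vertices of $G$. Let $$I=I(G)=\langle\, x_ix_j \mid \{x_i,x_j\}\text{ is an edge of }G\,\rangle\subseteq S$$ be the edge ideal of $G$, and let $\beta(G)$ be the matching number of $G$, i.e. the maximum number of pairwise disjoint edges of $G$. For a finitely generated graded $S$-module $M$ let $$\operatorname{reg} M=\max\{\,j-i \mid \operatorname{Tor}^S_i(M,k)_j\neq 0\,\}$$ be its Castelnuovo–Mumford regularity, with $\operatorname{reg} 0=-\infty$. Then, for every integer $s\ge 1$, $$\operatorname{reg} I^s\le 2s+\beta(G)-1.$$ -/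

import Mathlib

open scoped TensorProduct

/-- The matching number of a graph on a finite vertex set: the largest number of edges in a
matching. -/
noncomputable def matchingNumber {V : Type*} (G : SimpleGraph V) : ℕ :=
  sSup {n : ℕ | ∃ M : G.Subgraph, M.IsMatching ∧ M.edgeSet.ncard = n}

/-- The edge ideal of `G` in the polynomial ring over `k` whose variables are the vertices. -/
noncomputable def edgeIdeal (k : Type*) [Field k] {V : Type*} (G : SimpleGraph V) :
    Ideal (MvPolynomial V k) :=
  Ideal.span {p | ∃ u v, G.Adj u v ∧ p = MvPolynomial.X u * MvPolynomial.X v}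

/-- The degree `j` part `S_j` of the standard graded polynomial ring `S = k[V]`, `j ∈ ℤ`. -/
noncomputable def polyPiece (k : Type*) [Field k] (V : Type*) (j : ℤ) : Submodule k (MvPolynomial V k) where
  carrier := {p | ∀ m, MvPolynomial.coeff m p ≠ 0 → ((m.degree : ℕ) : ℤ) = j}
  zero_mem' := by intro m hm; simp at hm
  add_mem' := by
    intro p q hp hq m hm
    by_cases h : MvPolynomial.coeff m p = 0
    · exact hq m (by simpa [h] using hm)
    · exact hp m h
  smul_mem' := by
    intro c p hp m hm
    exact hp m (fun h => hm (by simp [h]))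

/-- The degree `j` part of the graded free module `⨁_b S(-deg b)`: the `b`-th basis vector has
degree `deg b`. -/
noncomputable def freePiece (k : Type*) [Field k] (V : Type*) {r : ℕ} (deg : Fin r → ℤ) (j : ℤ) :
    Submodule k (Fin r → MvPolynomial V k) :=
  Submodule.pi Set.univ (fun b => polyPiece k V (j - deg b))

/-- The grading of an ideal `I` of `S` induced by that of `S`: the degree `j` part is
`I ∩ S_j`. -/
noncomputable def idealPiece {k : Type*} [Field k] {V : Type*} (I : Ideal (MvPolynomial V k)) (j : ℤ) :
    Submodule k I :=
  (polyPiece k V j).comap (I.subtype.restrictScalars k)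

/-- A graded free resolution `⋯ → F₂ → F₁ → F₀ → M → 0` (by finitely generated graded free
`S`-modules, with differentials and augmentation of degree `0`) of an `S`-module `M` whose degree
`j` part is `gr j`. Here `Fᵢ = ⨁_{b < rank i} S(-deg i b)`. -/
structure GradedFreeResolution {k : Type*} [Field k] (V : Type*) {M : Type*} [AddCommGroup M]
    [Module k M] [Module (MvPolynomial V k) M] [IsScalarTower k (MvPolynomial V k) M]
    (gr : ℤ → Submodule k M) where
  rank : ℕ → ℕ
  deg : ∀ i, Fin (rank i) → ℤ
  ε : (Fin (rank 0) → MvPolynomial V k) →ₗ[MvPolynomial V k] M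
  d : ∀ i, (Fin (rank (i + 1)) → MvPolynomial V k) →ₗ[MvPolynomial V k]
    (Fin (rank i) → MvPolynomial V k)
  ε_mem : ∀ j, ∀ f ∈ freePiece k V (deg 0) j, ε f ∈ gr j
  d_mem : ∀ i j, ∀ f ∈ freePiece k V (deg (i + 1)) j, d i f ∈ freePiece k V (deg i) j
  ε_surjective : Function.Surjective ε
  exact_zero : Function.Exact (d 0) ε
  exact_succ : ∀ i, Function.Exact (d (i + 1)) (d i)

/-- The residue field `k = S / (x_v : v ∈ V)`, as an `S`-module. -/
noncomputable abbrev VarQuotient (k : Type*) [Field k] (V : Type*) : Type _ :=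
  MvPolynomial V k ⧸ (Ideal.span (Set.range (MvPolynomial.X : V → MvPolynomial V k)))

namespace GradedFreeResolution

variable {k : Type*} [Field k] {V : Type*} {M : Type*} [AddCommGroup M] [Module k M]
  [Module (MvPolynomial V k) M] [IsScalarTower k (MvPolynomial V k) M]
  {gr : ℤ → Submodule k M}

/-- The `i`-th module `k ⊗ Fᵢ` of the complex `k ⊗ F`. -/
noncomputable abbrev Term (F : GradedFreeResolution V gr) (i : ℕ) : Type _ :=
  VarQuotient k V ⊗[MvPolynomial V k] (Fin (F.rank i) → MvPolynomial V k)

/-- The cycles of `k ⊗ F` in homological degree `i`. -/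
noncomputable def cycles (F : GradedFreeResolution V gr) : ∀ i, Submodule (MvPolynomial V k) (F.Term i)
  | 0 => ⊤
  | i + 1 => LinearMap.ker ((F.d i).lTensor (VarQuotient k V))

/-- The boundaries of `k ⊗ F` in homological degree `i`. -/
noncomputable def boundaries (F : GradedFreeResolution V gr) (i : ℕ) :
    Submodule (MvPolynomial V k) (F.Term i) :=
  LinearMap.range ((F.d i).lTensor (VarQuotient k V))

/-- The degree `j` part of `k ⊗ Fᵢ`. Since `k` is concentrated in degree `0`, it consists of the
elements `1 ⊗ f` with `f ∈ Fᵢ` of degree `j`. -/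
noncomputable def termPiece (F : GradedFreeResolution V gr) (i : ℕ) (j : ℤ) : Submodule k (F.Term i) :=
  (freePiece k V (F.deg i) j).map
    ((TensorProduct.mk (MvPolynomial V k) (VarQuotient k V) _ 1).restrictScalars k)

/-- The degree `j` part `Torᵢ(M, k)_j` of the homology `Torᵢ(M, k) = cycles / boundaries` of
`k ⊗ F` in homological degree `i`: the classes, modulo boundaries, of the cycles of degree `j`. -/
noncomputable def torPiece (F : GradedFreeResolution V gr) (i : ℕ) (j : ℤ) :
    Submodule k (F.Term i ⧸ F.boundaries i) :=
  (F.termPiece i j ⊓ (F.cycles i).restrictScalars k).map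
    ((F.boundaries i).mkQ.restrictScalars k)

end GradedFreeResolution

/-- The Castelnuovo–Mumford regularity `max {j - i | Torᵢ(M, k)_j ≠ 0}` of an `S`-module `M` with
grading `gr`, as an extended real number (`⊥` if there is no such pair, that is, if `M = 0`). -/
noncomputable def regularity {k : Type*} [Field k] (V : Type*) {M : Type*} [AddCommGroup M]
    [Module k M] [Module (MvPolynomial V k) M] [IsScalarTower k (MvPolynomial V k) M]
    (gr : ℤ → Submodule k M) : EReal :=
  sSup {x : EReal | ∃ (i : ℕ) (j : ℤ),
    (∃ F : GradedFreeResolution V gr, F.torPiece i j ≠ ⊥) ∧ x = (((j - i : ℤ) : ℝ) : EReal)}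

/-- The regularity of an ideal of `S`, as a graded `S`-module. -/
noncomputable def idealRegularity {k : Type*} [Field k] {V : Type*}
    (I : Ideal (MvPolynomial V k)) : EReal :=
  regularity V (idealPiece I)

section Existence

variable {k : Type*} [Field k] {V : Type*}

theorem smul_mem_polyPiece {a b : ℤ} {p q : MvPolynomial V k} (hp : p ∈ polyPiece k V a)
    (hq : q ∈ polyPiece k V b) : p * q ∈ polyPiece k V (a + b) := by
  classical
  intro m hm
  rw [MvPolynomial.coeff_mul] at hm
  obtain ⟨⟨x, y⟩, hxy, h⟩ := Finset.exists_ne_zero_of_sum_ne_zero hm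
  have h1 := hp x (left_ne_zero_of_mul h)
  have h2 := hq y (right_ne_zero_of_mul h)
  rw [Finset.HasAntidiagonal.mem_antidiagonal] at hxy
  rw [← hxy, map_add]
  push_cast
  omega

theorem monomial_mem_polyPiece (m : V →₀ ℕ) (c : k) :
    MvPolynomial.monomial m c ∈ polyPiece k V (m.degree : ℕ) := by
  classical
  intro m' hm'
  rw [MvPolynomial.coeff_monomial] at hm'
  have : m = m' := by by_contra h; simp [h] at hm'
  rw [this]

theorem iSupIndep_polyPiece : iSupIndep (polyPiece k V) := by
  classical
  rw [iSupIndep_iff_finsetSum_eq_zero_imp_eq_zero]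
  intro s v h0 hs i hi
  ext m
  by_contra hne
  have hm := h0 i hi m (by simpa using hne)
  have h := congrArg (MvPolynomial.coeff m) hs
  rw [MvPolynomial.coeff_sum, Finset.sum_eq_single i] at h
  · exact hne (by simpa using h)
  · intro b hb hbi
    by_contra hc
    exact hbi ((h0 b hb m hc).symm.trans hm)
  · intro h; exact absurd hi h

theorem iSupIndep_freePiece {r : ℕ} (deg : Fin r → ℤ) : iSupIndep (freePiece k V deg) := by
  classical
  rw [iSupIndep_iff_finsetSum_eq_zero_imp_eq_zero]
  intro s v h0 hs i hi
  funext b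
  have hind := (iSupIndep_iff_finsetSum_eq_zero_imp_eq_zero _).1
    ((iSupIndep_polyPiece (k := k) (V := V)).comp (f := fun j : ℤ => j - deg b)
      (fun x y h => by simpa using h))
  refine hind s (fun j => v j b) (fun j hj => h0 j hj b (Set.mem_univ b)) ?_ i hi
  have := congrFun hs b
  simpa using this

theorem iSup_freePiece {r : ℕ} (deg : Fin r → ℤ) : ⨆ j, freePiece k V deg j = ⊤ := by
  classical
  rw [eq_top_iff]
  intro f _
  rw [← Finset.univ_sum_single f]
  refine Submodule.sum_mem _ fun b _ => ?_
  rw [(f b).as_sum, ← LinearMap.single_apply (R := k), map_sum]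
  refine Submodule.sum_mem _ fun m _ => ?_
  refine Submodule.mem_iSup_of_mem ((m.degree : ℕ) + deg b : ℤ) ?_
  intro b' _
  by_cases h : b' = b
  · subst h
    simpa using monomial_mem_polyPiece m _
  · simp [h]

theorem smul_mem_freePiece {r : ℕ} (deg : Fin r → ℤ) {a b : ℤ} {p : MvPolynomial V k}
    {f : Fin r → MvPolynomial V k} (hp : p ∈ polyPiece k V a) (hf : f ∈ freePiece k V deg b) :
    p • f ∈ freePiece k V deg (a + b) := by
  intro i hi
  have := smul_mem_polyPiece hp (hf i hi)
  rwa [← add_sub_assoc] at this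

/-- A finitely generated homogeneous submodule `K` of a graded module is the image of a graded
map from a finitely generated graded free module, and the kernel of that map is again generated
by homogeneous elements. -/
theorem exists_graded_cover {M : Type*} [AddCommGroup M] [Module k M]
    [Module (MvPolynomial V k) M] [IsScalarTower k (MvPolynomial V k) M]
    (gr : ℤ → Submodule k M) (hind : iSupIndep gr)
    (hsmul : ∀ a b, ∀ p ∈ polyPiece k V a, ∀ x ∈ gr b, p • x ∈ gr (a + b))
    (K : Submodule (MvPolynomial V k) M) (hfg : K.FG)
    (hK : K ≤ Submodule.span _ {x | x ∈ K ∧ ∃ j, x ∈ gr j}) :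
    ∃ (r : ℕ) (deg : Fin r → ℤ) (φ : (Fin r → MvPolynomial V k) →ₗ[MvPolynomial V k] M),
      LinearMap.range φ = K ∧ (∀ j, ∀ f ∈ freePiece k V deg j, φ f ∈ gr j) ∧
      LinearMap.ker φ ≤
        Submodule.span _ {f | f ∈ LinearMap.ker φ ∧ ∃ j, f ∈ freePiece k V deg j} := by
  classical
  have hspan : Submodule.span (MvPolynomial V k) {x | x ∈ K ∧ ∃ j, x ∈ gr j} = K :=
    le_antisymm (Submodule.span_le.2 fun x hx => hx.1) hK
  obtain ⟨T, hT, hTs⟩ := (Submodule.fg_span_iff_fg_span_finset_subset _).1 (hspan.symm ▸ hfg)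
  choose dg hdg using fun x : T => (hT x.2).2
  let e := T.equivFin
  let φ := Fintype.linearCombination (MvPolynomial V k) (fun b => ((e.symm b : T) : M))
  have hφ : ∀ j, ∀ f ∈ freePiece k V (fun b => dg (e.symm b)) j, φ f ∈ gr j := by
    intro j f hf
    simp only [φ, Fintype.linearCombination_apply]
    refine Submodule.sum_mem _ fun b _ => ?_
    have := hsmul _ _ _ (hf b (Set.mem_univ b)) _ (hdg (e.symm b))
    simpa using this
  refine ⟨T.card, fun b => dg (e.symm b), φ, ?_, hφ, ?_⟩
  · rw [Fintype.range_linearCombination, ← hspan, hTs]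
    congr 1
    ext x
    constructor
    · rintro ⟨b, rfl⟩; exact (e.symm b).2
    · intro hx; exact ⟨e ⟨x, hx⟩, by simp⟩
  · intro f hf
    have hmem : f ∈ ⨆ j, freePiece k V (fun b => dg (e.symm b)) j := by
      rw [iSup_freePiece]; trivial
    obtain ⟨g, hg, hgf⟩ := (Submodule.mem_iSup_iff_exists_finsupp _ _).1 hmem
    have h0 : ∑ j ∈ g.support, φ (g j) = 0 := by
      rw [← map_sum]
      have : (∑ j ∈ g.support, g j) = f := hgf
      rw [this]; exact hf
    have hz := (iSupIndep_iff_finsetSum_eq_zero_imp_eq_zero _).1 hind g.support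
      (fun j => φ (g j)) (fun j _ => hφ j _ (hg j)) h0
    rw [← hgf]
    exact Submodule.sum_mem _ fun j hj => Submodule.subset_span ⟨hz j hj, j, hg j⟩

/-- Every finitely generated graded `S`-module has a graded free resolution. -/
theorem GradedFreeResolution.nonempty [Finite V] {M : Type*} [AddCommGroup M] [Module k M]
    [Module (MvPolynomial V k) M] [IsScalarTower k (MvPolynomial V k) M]
    [Module.Finite (MvPolynomial V k) M] (gr : ℤ → Submodule k M) (hgr : DirectSum.IsInternal gr)
    (hsmul : ∀ a b, ∀ p ∈ polyPiece k V a, ∀ x ∈ gr b, p • x ∈ gr (a + b)) :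
    Nonempty (GradedFreeResolution V gr) := by
  classical
  rw [DirectSum.isInternal_submodule_iff_iSupIndep_and_iSup_eq_top] at hgr
  obtain ⟨hind, htop⟩ := hgr
  obtain ⟨r₀, deg₀, ε, hr, hε, hker⟩ := exists_graded_cover gr hind hsmul ⊤ Module.Finite.fg_top (by
    intro x _
    have hx : x ∈ ⨆ j, gr j := by rw [htop]; trivial
    induction hx using Submodule.iSup_induction' with
    | mem j x hx => exact Submodule.subset_span ⟨trivial, j, hx⟩
    | zero => exact Submodule.zero_mem _
    | add x y _ _ h1 h2 => exact Submodule.add_mem _ (h1 trivial) (h2 trivial))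
  let St := Σ' (r : ℕ) (deg : Fin r → ℤ) (K : Submodule (MvPolynomial V k)
    (Fin r → MvPolynomial V k)), K ≤ Submodule.span _ {x | x ∈ K ∧ ∃ j, x ∈ freePiece k V deg j}
  choose r deg φ h1 h2 h3 using fun s : St => exists_graded_cover (freePiece k V s.2.1)
    (iSupIndep_freePiece s.2.1) (fun _ _ _ hp _ hx => smul_mem_freePiece s.2.1 hp hx) s.2.2.1
    (IsNoetherian.noetherian _) s.2.2.2
  let st : ℕ → St := fun n => Nat.rec ⟨r₀, deg₀, LinearMap.ker ε, hker⟩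
    (fun _ s => ⟨r s, deg s, LinearMap.ker (φ s), h3 s⟩) n
  exact ⟨{
    rank := fun n => (st n).1
    deg := fun n => (st n).2.1
    ε := ε
    d := fun n => φ (st n)
    ε_mem := hε
    d_mem := fun n j f hf => h2 (st n) j f hf
    ε_surjective := LinearMap.range_eq_top.1 hr
    exact_zero := LinearMap.exact_iff.2 (h1 (st 0)).symm
    exact_succ := fun n => LinearMap.exact_iff.2 (h1 (st (n + 1))).symm }⟩

/-- A homogeneous ideal is the direct sum of its pieces `I ∩ S_j`. -/
theorem isInternal_idealPiece (I : Ideal (MvPolynomial V k))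
    (hI : I ≤ Ideal.span {p | p ∈ I ∧ ∃ j, p ∈ polyPiece k V j}) :
    DirectSum.IsInternal (idealPiece I) := by
  classical
  rw [DirectSum.isInternal_submodule_iff_iSupIndep_and_iSup_eq_top]
  refine ⟨?_, ?_⟩
  · rw [iSupIndep_iff_finsetSum_eq_zero_imp_eq_zero]
    intro s v h0 hs i hi
    have := (iSupIndep_iff_finsetSum_eq_zero_imp_eq_zero _).1
      (iSupIndep_polyPiece (k := k) (V := V)) s (fun j => (v j : MvPolynomial V k))
      (fun j hj => h0 j hj) (by simpa using congrArg Subtype.val hs) i hi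
    exact Subtype.ext this
  · suffices H : ∀ f ∈ I, f ∈ (⨆ j, idealPiece I j).map (I.subtype.restrictScalars k) by
      rw [eq_top_iff]
      rintro ⟨f, hf⟩ _
      obtain ⟨g, hg, rfl⟩ := H f hf
      exact hg
    intro f hf
    have hf' := hI hf
    induction hf' using Submodule.span_induction with
    | mem x hx =>
      exact ⟨⟨x, hx.1⟩, Submodule.mem_iSup_of_mem hx.2.choose hx.2.choose_spec, rfl⟩
    | zero => exact Submodule.zero_mem _
    | add x y hx hy h1 h2 =>
      have hle : Ideal.span {p | p ∈ I ∧ ∃ j, p ∈ polyPiece k V j} ≤ I :=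
        Ideal.span_le.2 fun p hp => hp.1
      exact Submodule.add_mem _ (h1 (hle hx)) (h2 (hle hy))
    | smul a x hx h =>
      have hle : Ideal.span {p | p ∈ I ∧ ∃ j, p ∈ polyPiece k V j} ≤ I :=
        Ideal.span_le.2 fun p hp => hp.1
      obtain ⟨⟨g, hgI⟩, hg, rfl⟩ := h (hle hx)
      clear hf hx hle
      change a • g ∈ _
      suffices H : ∀ y ∈ ⨆ j, idealPiece I j, a • y ∈ ⨆ j, idealPiece I j from
        ⟨a • ⟨g, hgI⟩, H _ hg, rfl⟩
      intro y hy
      induction hy using Submodule.iSup_induction' with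
      | mem j x hx =>
        rw [a.as_sum, Finset.sum_smul]
        refine Submodule.sum_mem _ fun m _ => ?_
        exact Submodule.mem_iSup_of_mem ((m.degree : ℕ) + j : ℤ)
          (smul_mem_polyPiece (monomial_mem_polyPiece m _) hx)
      | zero => simp
      | add x y _ _ h1 h2 => rw [smul_add]; exact Submodule.add_mem _ h1 h2

theorem edgeIdeal_pow_le_span (G : SimpleGraph V) (s : ℕ) :
    edgeIdeal k G ^ s ≤
      Ideal.span {p | p ∈ edgeIdeal k G ^ s ∧ ∃ j, p ∈ polyPiece k V j} := by
  induction s with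
  | zero =>
    rw [pow_zero, Ideal.one_eq_top, top_le_iff, Ideal.eq_top_iff_one]
    exact Ideal.subset_span ⟨trivial, ((0 : V →₀ ℕ).degree : ℕ), monomial_mem_polyPiece 0 1⟩
  | succ s ih =>
    rw [pow_succ]
    refine (Ideal.mul_mono_left ih).trans ?_
    conv_lhs => rw [edgeIdeal, Ideal.span_mul_span']
    refine Ideal.span_le.2 ?_
    rintro _ ⟨p, ⟨hp, j, hj⟩, q, ⟨u, v, huv, rfl⟩, rfl⟩
    refine Ideal.subset_span ⟨Ideal.mul_mem_mul hp (Ideal.subset_span ⟨u, v, huv, rfl⟩),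
      _, smul_mem_polyPiece hj (smul_mem_polyPiece (monomial_mem_polyPiece _ 1)
        (monomial_mem_polyPiece _ 1))⟩

/-- The powers of an edge ideal have graded free resolutions. -/
theorem GradedFreeResolution.nonempty_edgeIdeal_pow [Finite V] (G : SimpleGraph V) (s : ℕ) :
    Nonempty (GradedFreeResolution V (idealPiece (edgeIdeal k G ^ s))) :=
  GradedFreeResolution.nonempty _ (isInternal_idealPiece _ (edgeIdeal_pow_le_span G s))
    (fun _ _ _ hp _ hx => smul_mem_polyPiece hp hx)

end Existence

-- The bound is proved for a larger family of monomial ideals. Let `e` be a product of `t ≤ s`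
-- edges, `P` a set of vertices matched by edges into its complement, and `W` a set of variables.
-- Let `J` be generated by the monomials in the variables of `W` that lie in `I^s : (e * x_P)`. If
-- `2t + |P| < 2s + β`, then `reg J ≤ 2s + β - 1 - (2t + |P|)`; the theorem is the case `t = 0`, `P
-- = ∅`, `W = V` (`regLE_colonExponents`).
--
-- For a variable `w`, let `J'` be generated by the monomials of `J` free of `w`. The exact sequence
-- `0 → J'(-1) → (J : w)(-1) ⊕ J' → J → 0` gives `reg J ≤ max (reg (J : w) + 1) (reg J')`
-- (`RegLE.of_variable`). Passing to `J'` deletes `w` from `W`. Passing to `J : w` is useful when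
-- `2t + |P|` grows by one: either `w` combines with `e` and an element of `P` into a product of `t
-- + 1` edges, or `w` can be added to `P` together with a new partner, which happens at most `β`
-- times.
--
-- When neither move is possible and no two elements of `P` can be absorbed into `e`, an alternating
-- path argument (`IsEdgeProduct.exists_augment`) shows `J = 0`. At `t = s` the ideal is the whole
-- ring.
--
-- Regularity is bounded through graded projective resolutions (`HasRes`). The pieces of a `GrMod`
-- need not decompose the module, so lifting in the graded sense and ordinary projectivity are
-- carried separately. `HasRes.regularity_le` returns to the Tor modules by comparing resolutions.

universe u v

/-! ### Graded modules and resolutions with bounded generator degrees -/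

/-- A graded module over the standard graded polynomial ring `k[V]`. -/
structure GrMod (k : Type u) [Field k] (V : Type v) where
  carrier : Type (max u v)
  [grp : AddCommGroup carrier]
  [mod : Module (MvPolynomial V k) carrier]
  gr : ℤ → AddSubgroup carrier
  smul_mem : ∀ a b, ∀ p ∈ polyPiece k V a, ∀ x ∈ gr b, p • x ∈ gr (a + b)

namespace GrMod

variable {k : Type u} [Field k] {V : Type v}

instance : CoeSort (GrMod k V) (Type (max u v)) := ⟨GrMod.carrier⟩

noncomputable instance (M : GrMod k V) : AddCommGroup M := M.grp

noncomputable instance (M : GrMod k V) : Module (MvPolynomial V k) M := M.mod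

/-- A linear map preserving degrees. -/
def IsGraded {M N : GrMod k V} (f : M →ₗ[MvPolynomial V k] N) : Prop :=
  ∀ j, ∀ x ∈ M.gr j, f x ∈ N.gr j

/-- A linear map mapping every piece onto the corresponding piece. -/
def IsGradedOnto {M N : GrMod k V} (f : M →ₗ[MvPolynomial V k] N) : Prop :=
  ∀ j, ∀ y ∈ N.gr j, ∃ x ∈ M.gr j, f x = y

/-- The kernel of a linear map, with the induced pieces. -/
noncomputable def ker {M N : GrMod k V} (f : M →ₗ[MvPolynomial V k] N) : GrMod k V where
  carrier := LinearMap.ker f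
  gr j := (M.gr j).comap (LinearMap.ker f).subtype.toAddMonoidHom
  smul_mem a b p hp x := M.smul_mem a b p hp x.1

/-- The product of two graded modules. -/
noncomputable def prod (M N : GrMod k V) : GrMod k V where
  carrier := M × N
  gr j := (M.gr j).prod (N.gr j)
  smul_mem a b p hp _ hx := ⟨M.smul_mem a b p hp _ hx.1, N.smul_mem a b p hp _ hx.2⟩

/-- The ideal generated by the variables. -/
noncomputable abbrev varIdeal (k : Type u) [Field k] (V : Type v) : Ideal (MvPolynomial V k) :=
  Ideal.span (Set.range MvPolynomial.X)

/-- `F` is projective, also in the graded sense, and needs no generators of degree `> d`. -/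
structure IsGradedProjective (F : GrMod k V) (d : ℤ) : Prop where
  lift : ∀ (B C : GrMod k V) (g : B →ₗ[MvPolynomial V k] C), IsGradedOnto g →
    ∀ f : F →ₗ[MvPolynomial V k] C, IsGraded f →
      ∃ h : F →ₗ[MvPolynomial V k] B, IsGraded h ∧ g ∘ₗ h = f
  proj : Module.Projective (MvPolynomial V k) F
  small : ∀ j, d < j → ∀ x ∈ F.gr j, x ∈ varIdeal k V • (⊤ : Submodule (MvPolynomial V k) F)

theorem IsGradedProjective.prod {F F' : GrMod k V} {d : ℤ} (h : F.IsGradedProjective d)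
    (h' : F'.IsGradedProjective d) : (F.prod F').IsGradedProjective d where
  lift B C g hg f hf := by
    obtain ⟨a, ha, hga⟩ := h.lift B C g hg (f ∘ₗ LinearMap.inl (MvPolynomial V k) F F')
      fun j x hx => hf j (x, 0) ⟨hx, zero_mem _⟩
    obtain ⟨b, hb, hgb⟩ := h'.lift B C g hg (f ∘ₗ LinearMap.inr (MvPolynomial V k) F F')
      fun j x hx => hf j (0, x) ⟨zero_mem _, hx⟩
    refine ⟨a.coprod b, fun j x hx => add_mem (ha j _ hx.1) (hb j _ hx.2), ?_⟩
    have : g ∘ₗ a.coprod b = f := (LinearMap.comp_coprod g a b).trans <| by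
      rw [hga, hgb]
      exact LinearMap.coprod_comp_inl_inr (M := F) (M₂ := F') f
    exact this
  proj := by
    have := h.proj
    have := h'.proj
    exact inferInstanceAs (Module.Projective (MvPolynomial V k) (F × F'))
  small j hj x hx := by
    have h1 := Submodule.smul_top_le_comap_smul_top (varIdeal k V)
      (LinearMap.inl (MvPolynomial V k) F F') (h.small j hj _ hx.1)
    have h2 := Submodule.smul_top_le_comap_smul_top (varIdeal k V)
      (LinearMap.inr (MvPolynomial V k) F F') (h'.small j hj _ hx.2)
    have h3 := add_mem (Submodule.mem_comap.1 h1) (Submodule.mem_comap.1 h2)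
    have : (x.1, x.2) ∈ varIdeal k V • (⊤ : Submodule (MvPolynomial V k) (F × F')) := by
      simpa using h3
    exact this

/-- `F` covers `M` by a graded projective module generated in degrees at most `r`. -/
structure IsCover (F M : GrMod k V) (ε : F →ₗ[MvPolynomial V k] M) (r : ℤ) : Prop where
  proj : F.IsGradedProjective r
  graded : IsGraded ε
  onto : IsGradedOnto ε
  surj : Function.Surjective ε

/-- `M` has a graded projective resolution of length less than `n`, whose `i`-th term is
generated in degrees at most `r + i`. -/
def HasRes : ℕ → GrMod k V → ℤ → Prop
  | 0, M, _ => Subsingleton M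
  | n + 1, M, r => ∃ (F : GrMod k V) (ε : F →ₗ[MvPolynomial V k] M), IsCover F M ε r ∧
      HasRes n (ker ε) (r + 1)

theorem isGradedProjective_of_subsingleton (M : GrMod k V) [Subsingleton M] (d : ℤ) :
    M.IsGradedProjective d where
  lift B C g _ f _ := ⟨0, fun j x _ => zero_mem _, by
    ext x; rw [Subsingleton.elim x 0]; simp⟩
  proj := inferInstance
  small j _ x _ := by rw [Subsingleton.elim x 0]; exact zero_mem _

theorem IsGradedProjective.isCover_id {M : GrMod k V} {d : ℤ} (h : M.IsGradedProjective d) :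
    IsCover M M LinearMap.id d where
  proj := h
  graded _ _ hx := hx
  onto _ y hy := ⟨y, hy, rfl⟩
  surj := Function.surjective_id

theorem IsGradedProjective.hasRes {M : GrMod k V} {d : ℤ} (h : M.IsGradedProjective d) :
    HasRes 1 M d :=
  ⟨M, LinearMap.id, h.isCover_id, ⟨fun x y => Subtype.ext (x.2.trans y.2.symm)⟩⟩

theorem HasRes.succ : ∀ {n : ℕ} {M : GrMod k V} {r : ℤ}, HasRes n M r → HasRes (n + 1) M r
  | 0, M, r, h => by
    have : Subsingleton M := h
    exact (isGradedProjective_of_subsingleton M r).hasRes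
  | n + 1, M, r, ⟨F, ε, hF, h⟩ => ⟨F, ε, hF, h.succ⟩

theorem HasRes.mono_length {n m : ℕ} {M : GrMod k V} {r : ℤ} (h : HasRes n M r) (hnm : n ≤ m) :
    HasRes m M r := by
  induction hnm with
  | refl => exact h
  | step _ ih => exact ih.succ

theorem IsGradedProjective.mono {M : GrMod k V} {r r' : ℤ} (h : M.IsGradedProjective r)
    (hr : r ≤ r') : M.IsGradedProjective r' :=
  ⟨h.lift, h.proj, fun j hj => h.small j (hr.trans_lt hj)⟩

theorem HasRes.mono : ∀ {n : ℕ} {M : GrMod k V} {r r' : ℤ}, HasRes n M r → r ≤ r' →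
    HasRes n M r'
  | 0, _, _, _, h, _ => h
  | n + 1, _, _, _, ⟨F, ε, hF, h⟩, hr =>
    ⟨F, ε, ⟨hF.proj.mono hr, hF.graded, hF.onto, hF.surj⟩, h.mono (by omega)⟩

/-- A short exact sequence of graded modules. -/
structure IsShortExact {A B C : GrMod k V} (f : A →ₗ[MvPolynomial V k] B)
    (g : B →ₗ[MvPolynomial V k] C) : Prop where
  inj : Function.Injective f
  exact : Function.Exact f g
  surj : Function.Surjective g
  mem_iff : ∀ j a, f a ∈ B.gr j ↔ a ∈ A.gr j
  graded : IsGraded g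
  onto : IsGradedOnto g

/-- Horseshoe lemma: the cover of `C` lifts to `B`, its sum with the cover of `A` covers `B`, and
the kernels again form a short exact sequence. -/
theorem HasRes.of_extension : ∀ {n : ℕ} {A B C : GrMod k V} {f : A →ₗ[MvPolynomial V k] B}
    {g : B →ₗ[MvPolynomial V k] C} {r : ℤ}, IsShortExact f g → HasRes n A r → HasRes n C r →
    HasRes n B r
  | 0, A, B, C, f, g, r, h, hA, hC => by
    have : Subsingleton A := hA
    have : Subsingleton C := hC
    refine ⟨fun x y => ?_⟩
    obtain ⟨a, ha⟩ := (h.exact (x - y)).1 (Subsingleton.elim _ _)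
    rw [Subsingleton.elim a 0, map_zero] at ha
    exact sub_eq_zero.1 ha.symm
  | n + 1, A, B, C, f, g, r, h, ⟨F, ε, hF, hA⟩, ⟨F', ε', hF', hC⟩ => by
    obtain ⟨l, hl, hgl⟩ := hF'.proj.lift B C g h.onto ε' hF'.graded
    have hgl' : ∀ y, g (l y) = ε' y := fun y => LinearMap.congr_fun hgl y
    have hgf : ∀ a, g (f a) = 0 := fun a => (h.exact _).2 ⟨a, rfl⟩
    let η : F.prod F' →ₗ[MvPolynomial V k] B := (f ∘ₗ ε).coprod l
    have hη : ∀ (x : F) (y : F'), η (x, y) = f (ε x) + l y := fun x y => rfl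
    have hgη : ∀ z : F.prod F', g (η z) = ε' z.2 := fun z => by
      rw [show η z = f (ε z.1) + l z.2 from rfl, map_add, hgf, zero_add, hgl']
    refine ⟨F.prod F', η, ⟨hF.proj.prod hF'.proj, ?_, ?_, ?_⟩, ?_⟩
    · intro j z hz
      exact add_mem ((h.mem_iff _ _).2 (hF.graded j _ hz.1)) (hl j _ hz.2)
    · intro j b hb
      obtain ⟨y, hy, hyb⟩ := hF'.onto j _ (h.graded j b hb)
      obtain ⟨a, ha⟩ := (h.exact (b - l y)).1 (by rw [map_sub, hgl', hyb, sub_self])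
      obtain ⟨x, hx, hxa⟩ := hF.onto j a ((h.mem_iff _ _).1 (ha ▸ sub_mem hb (hl j y hy)))
      exact ⟨(x, y), ⟨hx, hy⟩, by rw [hη, hxa, ha, sub_add_cancel]⟩
    · intro b
      obtain ⟨y, hyb⟩ := hF'.surj (g b)
      obtain ⟨a, ha⟩ := (h.exact (b - l y)).1 (by rw [map_sub, hgl', hyb, sub_self])
      obtain ⟨x, hxa⟩ := hF.surj a
      exact ⟨(x, y), by rw [hη, hxa, ha, sub_add_cancel]⟩
    · let i : ker ε →ₗ[MvPolynomial V k] ker η :=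
        LinearMap.codRestrict (LinearMap.ker η)
          (LinearMap.inl (MvPolynomial V k) F F' ∘ₗ (LinearMap.ker ε).subtype) fun x => by
            have : ε x.1 = 0 := x.2
            change f (ε x.1) + l 0 = 0
            rw [this, map_zero, map_zero, add_zero]
      let p : ker η →ₗ[MvPolynomial V k] ker ε' :=
        LinearMap.codRestrict (LinearMap.ker ε')
          (LinearMap.snd (MvPolynomial V k) F F' ∘ₗ (LinearMap.ker η).subtype) fun z => by
            have : η z.1 = 0 := z.2
            change ε' z.1.2 = 0
            rw [← hgη, this, map_zero]
      -- For `y` in the kernel of `ε'`, the element `l y` comes from `A`; correcting by a preimage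
      -- in `F` lifts `y` to the kernel of `η`.
      have key : ∀ (y : F') (a : A), ε' y = 0 → f a = -l y → ∀ x, ε x = a → η (x, y) = 0 := by
        intro y a _ ha x hx
        rw [hη, hx, ha, neg_add_cancel]
      refine HasRes.of_extension (f := i) (g := p) ⟨?_, ?_, ?_, ?_, ?_, ?_⟩ hA hC
      · intro x y hxy
        exact Subtype.ext (congrArg (fun z : ker η => z.1.1) hxy)
      · intro z
        constructor
        · intro hz
          have hz2 : z.1.2 = 0 := congrArg Subtype.val hz
          have hz1 : η z.1 = 0 := z.2
          refine ⟨⟨z.1.1, ?_⟩, Subtype.ext (Prod.ext rfl hz2.symm)⟩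
          apply h.inj
          change f (ε z.1.1) + l z.1.2 = 0 at hz1
          rw [hz2, map_zero, add_zero] at hz1
          rw [hz1, map_zero]
        · rintro ⟨x, rfl⟩
          rfl
      · intro y
        have hy : ε' y.1 = 0 := y.2
        obtain ⟨a, ha⟩ := (h.exact (-l y.1)).1 (by rw [map_neg, hgl', hy, neg_zero])
        obtain ⟨x, hx⟩ := hF.surj a
        exact ⟨⟨(x, y.1), key y.1 a hy ha x hx⟩, rfl⟩
      · intro j x
        exact ⟨fun hx => hx.1, fun hx => ⟨hx, zero_mem _⟩⟩
      · intro j z hz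
        exact hz.2
      · intro j y hyj
        have hy : ε' y.1 = 0 := y.2
        obtain ⟨a, ha⟩ := (h.exact (-l y.1)).1 (by rw [map_neg, hgl', hy, neg_zero])
        obtain ⟨x, hxj, hx⟩ := hF.onto j a
          ((h.mem_iff _ _).1 (ha ▸ neg_mem (hl j y.1 hyj)))
        exact ⟨⟨(x, y.1), key y.1 a hy ha x hx⟩, ⟨hxj, hyj⟩, rfl⟩

/-- A cover `F → B` followed by `B → C` covers `C`, and the kernel of the composite is an extension
of `A` by the kernel of `F → B`. It sits one step further in the resolution, whence the bound `r +
1` for `A`. -/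
theorem HasRes.of_quotient {n : ℕ} {A B C : GrMod k V} {f : A →ₗ[MvPolynomial V k] B}
    {g : B →ₗ[MvPolynomial V k] C} {r : ℤ} (h : IsShortExact f g) (hA : HasRes n A (r + 1))
    (hB : HasRes (n + 1) B r) : HasRes (n + 1) C r := by
  obtain ⟨F, ε, hF, hK⟩ := hB
  refine ⟨F, g ∘ₗ ε, ⟨hF.proj, fun j x hx => h.graded j _ (hF.graded j x hx), ?_,
    h.surj.comp hF.surj⟩, ?_⟩
  · intro j c hc
    obtain ⟨b, hb, rfl⟩ := h.onto j c hc
    obtain ⟨x, hx, rfl⟩ := hF.onto j b hb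
    exact ⟨x, hx, rfl⟩
  · let e := LinearEquiv.ofInjective f h.inj
    have hmem : ∀ x : LinearMap.ker (g ∘ₗ ε), ε x.1 ∈ LinearMap.range f := fun x =>
      (h.exact _).1 x.2
    let i : ker ε →ₗ[MvPolynomial V k] ker (g ∘ₗ ε) :=
      Submodule.inclusion (LinearMap.ker_le_ker_comp ε g)
    let p : ker (g ∘ₗ ε) →ₗ[MvPolynomial V k] A :=
      e.symm.toLinearMap ∘ₗ LinearMap.codRestrict (LinearMap.range f)
        (ε ∘ₗ (LinearMap.ker (g ∘ₗ ε)).subtype) hmem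
    have hp : ∀ x : ker (g ∘ₗ ε), f (p x) = ε x.1 := fun x =>
      congrArg Subtype.val (e.apply_symm_apply ⟨ε x.1, hmem x⟩)
    have hgf : ∀ a, g (f a) = 0 := fun a => (h.exact _).2 ⟨a, rfl⟩
    refine HasRes.of_extension (f := i) (g := p) ⟨?_, ?_, ?_, ?_, ?_, ?_⟩ hK hA
    · exact Submodule.inclusion_injective _
    · intro x
      constructor
      · intro hx
        have : ε x.1 = 0 := by rw [← hp, hx, map_zero]
        exact ⟨⟨x.1, this⟩, rfl⟩
      · rintro ⟨y, rfl⟩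
        apply h.inj
        rw [hp, map_zero]
        exact y.2
    · intro a
      obtain ⟨x, hx⟩ := hF.surj (f a)
      refine ⟨⟨x, ?_⟩, h.inj ?_⟩
      · change g (ε x) = 0
        rw [hx, hgf]
      · exact (hp _).trans hx
    · intro j x
      exact Iff.rfl
    · intro j x hx
      rw [← h.mem_iff, hp]
      exact hF.graded j _ hx
    · intro j a ha
      obtain ⟨x, hxj, hx⟩ := hF.onto j (f a) ((h.mem_iff _ _).2 ha)
      refine ⟨⟨x, ?_⟩, hxj, h.inj ?_⟩
      · change g (ε x) = 0
        rw [hx, hgf]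
      · exact (hp _).trans hx

theorem isShortExact_prod (A C : GrMod k V) :
    IsShortExact (A := A) (B := A.prod C) (C := C) (LinearMap.inl (MvPolynomial V k) A C)
      (LinearMap.snd (MvPolynomial V k) A C) where
  inj := LinearMap.inl_injective
  exact := Function.Exact.inl_snd
  surj := LinearMap.snd_surjective
  mem_iff _ _ := ⟨fun h => h.1, fun h => ⟨h, zero_mem _⟩⟩
  graded _ _ hx := hx.2
  onto _ y hy := ⟨(0, y), ⟨zero_mem _, hy⟩, rfl⟩

end GrMod

/-! ### Chain maps and homotopies between resolutions -/

theorem exists_seq_of_step {P : ℕ → Type*} (good : ∀ n, P n → Prop)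
    (R : ∀ n, P n → P (n + 1) → Prop) (a₀ : P 0) (h0 : good 0 a₀)
    (step : ∀ n a, good n a → ∃ b, R n a b ∧ good (n + 1) b) :
    ∃ f : ∀ n, P n, f 0 = a₀ ∧ (∀ n, good n (f n)) ∧ ∀ n, R n (f n) (f (n + 1)) := by
  choose next h1 h2 using step
  let f : ∀ n, {a : P n // good n a} := fun n =>
    Nat.rec ⟨a₀, h0⟩ (fun n a => ⟨next n a.1 a.2, h2 n a.1 a.2⟩) n
  exact ⟨fun n => (f n).1, rfl, fun n => (f n).2, fun n => h1 n _ _⟩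

section Chain

variable {R : Type*} [CommRing R] {X Y : ℕ → Type*} [∀ n, AddCommGroup (X n)]
  [∀ n, Module R (X n)] [∀ n, AddCommGroup (Y n)] [∀ n, Module R (Y n)]
  {M : Type*} [AddCommGroup M] [Module R M]

/-- Lifting of the identity to a chain map from a complex to an exact complex, with all
components in classes of maps which satisfy the necessary lifting properties. -/
theorem exists_chainMap (εX : X 0 →ₗ[R] M) (dX : ∀ n, X (n + 1) →ₗ[R] X n)
    (εY : Y 0 →ₗ[R] M) (dY : ∀ n, Y (n + 1) →ₗ[R] Y n)
    (hX0 : ∀ x, εX (dX 0 x) = 0) (hX : ∀ n x, dX n (dX (n + 1) x) = 0)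
    (hY0 : Function.Exact (dY 0) εY) (hY : ∀ n, Function.Exact (dY (n + 1)) (dY n))
    (good : ∀ n, (X n →ₗ[R] Y n) → Prop)
    (h0 : ∃ φ, good 0 φ ∧ εY ∘ₗ φ = εX)
    (step : ∀ n φ, good n φ → (∀ x, φ (dX n x) ∈ LinearMap.range (dY n)) →
      ∃ φ', good (n + 1) φ' ∧ dY n ∘ₗ φ' = φ ∘ₗ dX n) :
    ∃ φ : ∀ n, X n →ₗ[R] Y n, (∀ n, good n (φ n)) ∧ (∀ x, εY (φ 0 x) = εX x) ∧
      ∀ n x, dY n (φ (n + 1) x) = φ n (dX n x) := by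
  obtain ⟨φ₀, hg, hφ₀⟩ := h0
  obtain ⟨φ, hφ', hφ, hc⟩ := exists_seq_of_step (P := fun n => X n →ₗ[R] Y n)
    (fun n φ => good n φ ∧ ∀ x, φ (dX n x) ∈ LinearMap.range (dY n))
    (fun n φ φ' => dY n ∘ₗ φ' = φ ∘ₗ dX n) φ₀
    ⟨hg, fun x => (hY0 _).1 (by rw [← LinearMap.comp_apply, hφ₀, hX0])⟩
    (by
      rintro n φ ⟨h1, h2⟩
      obtain ⟨φ', h3, h4⟩ := step n φ h1 h2
      refine ⟨φ', h4, h3, fun x => (hY n _).1 ?_⟩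
      rw [← LinearMap.comp_apply, h4, LinearMap.comp_apply, hX, map_zero])
  exact ⟨φ, fun n => (hφ n).1, fun x => by rw [hφ', ← hφ₀]; rfl,
    fun n x => LinearMap.congr_fun (hc n) x⟩

/-- A linear map out of a projective module into the range of another map lifts. -/
theorem exists_lift_of_mem_range {P A B : Type*} [AddCommGroup P] [Module R P]
    [AddCommGroup A] [Module R A] [AddCommGroup B] [Module R B] [Module.Projective R P]
    (g : A →ₗ[R] B) (f : P →ₗ[R] B) (h : ∀ x, f x ∈ LinearMap.range g) :
    ∃ l : P →ₗ[R] A, g ∘ₗ l = f := by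
  obtain ⟨l, hl⟩ := Module.projective_lifting_property g.rangeRestrict (f.codRestrict _ h)
    g.surjective_rangeRestrict
  refine ⟨l, LinearMap.ext fun x => ?_⟩
  exact congrArg Subtype.val (LinearMap.congr_fun hl x)

/-- A chain endomorphism of a projective resolution which lifts zero is null-homotopic. -/
theorem exists_nullHomotopy [∀ n, Module.Projective R (X n)]
    (ε : X 0 →ₗ[R] M) (d : ∀ n, X (n + 1) →ₗ[R] X n)
    (h0 : Function.Exact (d 0) ε) (hd : ∀ n, Function.Exact (d (n + 1)) (d n))
    (χ : ∀ n, X n →ₗ[R] X n) (hχ0 : ∀ x, ε (χ 0 x) = 0)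
    (hχ : ∀ n x, d n (χ (n + 1) x) = χ n (d n x)) :
    ∃ h : ∀ n, X n →ₗ[R] X (n + 1), (∀ x, d 0 (h 0 x) = χ 0 x) ∧
      ∀ n x, d (n + 1) (h (n + 1) x) + h n (d n x) = χ (n + 1) x := by
  obtain ⟨η, hη⟩ := exists_lift_of_mem_range (d 0) (χ 0) fun x => (h0 _).1 (hχ0 x)
  obtain ⟨h, hh, -, hc⟩ := exists_seq_of_step (P := fun n => X n →ₗ[R] X (n + 1))
    (fun n h => ∀ x, d n (h (d n x)) = χ n (d n x))
    (fun n h h' => ∀ x, d (n + 1) (h' x) + h (d n x) = χ (n + 1) x) η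
    (fun x => LinearMap.congr_fun hη _)
    (by
      intro n h h1
      obtain ⟨h', hh'⟩ := exists_lift_of_mem_range (d (n + 1)) (χ (n + 1) - h ∘ₗ d n) fun x =>
        (hd n _).1 (by simp [h1, hχ])
      have key : ∀ x, d (n + 1) (h' x) = χ (n + 1) x - h (d n x) :=
        fun x => LinearMap.congr_fun hh' x
      refine ⟨h', fun x => by rw [key, sub_add_cancel], fun x => ?_⟩
      rw [key, (hd n _).2 ⟨x, rfl⟩, map_zero, sub_zero])
  exact ⟨h, fun x => by rw [hh]; exact LinearMap.congr_fun hη x, hc⟩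

end Chain

/-! ### From resolutions to regularity -/

namespace GrMod

variable {k : Type u} [Field k] {V : Type v}

theorem HasRes.exists_cover {n : ℕ} {M : GrMod k V} {r : ℤ} (h : HasRes n M r) :
    ∃ (F : GrMod k V) (ε : F →ₗ[MvPolynomial V k] M), IsCover F M ε r ∧
      ∃ m, HasRes m (ker ε) (r + 1) := by
  obtain ⟨F, ε, hF, hK⟩ := h.succ
  exact ⟨F, ε, hF, n, hK⟩

/-- The successive covers are spliced. A trivial module covers itself, so there is always a next
cover and the length can be forgotten. -/
theorem HasRes.exists_resolution {n : ℕ} {M : GrMod k V} {r : ℤ} (h : HasRes n M r) :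
    ∃ (F : ℕ → GrMod k V) (ε : F 0 →ₗ[MvPolynomial V k] M)
      (d : ∀ i, F (i + 1) →ₗ[MvPolynomial V k] F i),
      (∀ i, (F i).IsGradedProjective (r + i)) ∧ IsGradedOnto ε ∧
      Function.Exact (d 0) ε ∧ (∀ i, Function.Exact (d (i + 1)) (d i)) ∧
      (∀ j, ∀ x ∈ (F 0).gr j, ε x = 0 → ∃ y ∈ (F 1).gr j, d 0 y = x) ∧
      ∀ i j, ∀ x ∈ (F (i + 1)).gr j, d i x = 0 → ∃ y ∈ (F (i + 2)).gr j, d (i + 1) y = x := by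
  choose F ε hF hK using fun (s : {s : GrMod k V × ℤ // ∃ n, HasRes n s.1 s.2}) =>
    s.2.choose_spec.exists_cover
  let st : ℕ → {s : GrMod k V × ℤ // ∃ n, HasRes n s.1 s.2} := fun i =>
    Nat.rec ⟨(M, r), n, h⟩ (fun _ s => ⟨(ker (ε s), s.1.2 + 1), hK s⟩) i
  have hst : ∀ i : ℕ, (st i).1.2 = r + i := by
    intro i
    induction i with
    | zero => simp [st]
    | succ i ih =>
      change (st i).1.2 + 1 = _
      rw [ih]; push_cast; ring
  let d : ∀ i, F (st (i + 1)) →ₗ[MvPolynomial V k] F (st i) := fun i =>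
    (LinearMap.ker (ε (st i))).subtype ∘ₗ ε (st (i + 1))
  have hd : ∀ i x, d i x = 0 ↔ ε (st (i + 1)) x = 0 := fun i x =>
    ⟨fun h => Subtype.ext h, fun h => congrArg Subtype.val h⟩
  have hex : ∀ i, Function.Exact (d i) (ε (st i)) := by
    intro i x
    constructor
    · intro hx
      obtain ⟨y, hy⟩ := (hF (st (i + 1))).surj ⟨x, hx⟩
      exact ⟨y, congrArg Subtype.val hy⟩
    · rintro ⟨y, rfl⟩
      exact (ε (st (i + 1)) y).2
  have hgr : ∀ i j, ∀ x ∈ (F (st i)).gr j, ε (st i) x = 0 →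
      ∃ y ∈ (F (st (i + 1))).gr j, d i y = x := by
    intro i j x hx h0
    obtain ⟨y, hy, hyx⟩ := (hF (st (i + 1))).onto j ⟨x, h0⟩ hx
    exact ⟨y, hy, congrArg Subtype.val hyx⟩
  exact ⟨fun i => F (st i), ε (st 0), d, fun i => hst i ▸ (hF (st i)).proj, (hF (st 0)).onto,
    hex 0, fun i x => (hd i x).trans (hex (i + 1) x), hgr 0,
    fun i j x hx h0 => hgr (i + 1) j x hx ((hd i x).1 h0)⟩

/-- A map out of a graded free module lifts along a degreewise condition. -/
theorem exists_lift_freePiece {r : ℕ} (deg : Fin r → ℤ) {B : GrMod k V} {C : Type*}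
    [AddCommGroup C] [Module (MvPolynomial V k) C] (g : B →ₗ[MvPolynomial V k] C)
    (f : (Fin r → MvPolynomial V k) →ₗ[MvPolynomial V k] C)
    (hf : ∀ j, ∀ x ∈ freePiece k V deg j, ∃ b ∈ B.gr j, g b = f x) :
    ∃ h : (Fin r → MvPolynomial V k) →ₗ[MvPolynomial V k] B,
      (∀ j, ∀ x ∈ freePiece k V deg j, h x ∈ B.gr j) ∧ g ∘ₗ h = f := by
  classical
  have hb : ∀ b : Fin r, Pi.single b (1 : MvPolynomial V k) ∈ freePiece k V deg (deg b) := by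
    intro b c _
    by_cases h : c = b
    · subst h
      simpa using monomial_mem_polyPiece (k := k) (0 : V →₀ ℕ) 1
    · simp [h]
  choose l hl hgl using fun b => hf _ _ (hb b)
  refine ⟨Fintype.linearCombination (MvPolynomial V k) l, fun j x hx => ?_, ?_⟩
  · rw [Fintype.linearCombination_apply]
    refine sum_mem fun b _ => ?_
    simpa using B.smul_mem _ _ _ (hx b (Set.mem_univ b)) _ (hl b)
  · refine LinearMap.pi_ext' fun b => LinearMap.ext_ring ?_
    simp [hgl]

/-- A graded module with a resolution generated in degrees at most `r + i` in position `i` has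
regularity at most `r`. -/
theorem HasRes.regularity_le {n : ℕ} {M : GrMod k V} {r : ℤ} (h : HasRes n M r)
    {N : Type (max u v)} [AddCommGroup N] [Module k N] [Module (MvPolynomial V k) N]
    [IsScalarTower k (MvPolynomial V k) N] (gr : ℤ → Submodule k N)
    (e : N ≃ₗ[MvPolynomial V k] M) (he : ∀ j, ∀ x ∈ gr j, e x ∈ M.gr j) :
    regularity V gr ≤ ((r : ℝ) : EReal) := by
  refine sSup_le ?_
  rintro _ ⟨i, j, ⟨F, hF⟩, rfl⟩
  rw [EReal.coe_le_coe_iff, Int.cast_le]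
  by_contra! hlt
  apply hF
  obtain ⟨Y, ε, d, hproj, honto, hex0, hex, hgr0, hgr⟩ := h.exists_resolution
  have hFd0 : ∀ x, F.ε (F.d 0 x) = 0 := fun x => (F.exact_zero _).2 ⟨x, rfl⟩
  have hFd : ∀ i x, F.d i (F.d (i + 1) x) = 0 := fun i x => (F.exact_succ i _).2 ⟨x, rfl⟩
  have hd0 : ∀ x, ε (d 0 x) = 0 := fun x => (hex0 _).2 ⟨x, rfl⟩
  have hd : ∀ i x, d i (d (i + 1) x) = 0 := fun i x => (hex i _).2 ⟨x, rfl⟩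
  obtain ⟨φ, hφ, hφ0, hφd⟩ := exists_chainMap (X := fun i => Fin (F.rank i) → MvPolynomial V k)
    (Y := fun i => (Y i).carrier) (e.toLinearMap ∘ₗ F.ε) F.d ε d
    (fun x => by simp [hFd0]) hFd hex0 hex
    (fun i φ => ∀ j, ∀ x ∈ freePiece k V (F.deg i) j, φ x ∈ (Y i).gr j)
    (exists_lift_freePiece (F.deg 0) ε (e.toLinearMap ∘ₗ F.ε) fun j x hx =>
      honto j _ (he j _ (F.ε_mem j x hx)))
    (by
      intro i φ hφ hr
      refine exists_lift_freePiece (F.deg (i + 1)) (d i) (φ ∘ₗ F.d i) fun j x hx => ?_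
      have hm := hφ j _ (F.d_mem i j x hx)
      obtain ⟨y, hy⟩ := hr x
      cases i with
      | zero => exact hgr0 j _ hm (hy ▸ hd0 y)
      | succ i => exact hgr i j _ hm (hy ▸ hd i y))
  have : ∀ i, Module.Projective (MvPolynomial V k) (Y i).carrier := fun i => (hproj i).proj
  -- The map back need not preserve degrees: only linearity will matter, which makes it respect
  -- multiples of the ideal of variables.
  obtain ⟨ψ, -, hψ0, hψd⟩ := exists_chainMap (X := fun i => (Y i).carrier)
    (Y := fun i => Fin (F.rank i) → MvPolynomial V k) ε d (e.toLinearMap ∘ₗ F.ε) F.d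
    hd0 hd (fun x => by
      rw [← F.exact_zero x]
      simp) F.exact_succ (fun _ _ => True)
    (by
      obtain ⟨l, hl⟩ := exists_lift_of_mem_range (e.toLinearMap ∘ₗ F.ε) ε fun x => by
        obtain ⟨y, hy⟩ := F.ε_surjective (e.symm (ε x))
        exact ⟨y, by simp [hy]⟩
      exact ⟨l, trivial, hl⟩)
    (fun i φ _ hr => by
      obtain ⟨l, hl⟩ := exists_lift_of_mem_range (F.d i) (φ ∘ₗ d i) hr
      exact ⟨l, trivial, hl⟩)
  obtain ⟨η, hη0, hη⟩ := exists_nullHomotopy (X := fun i => Fin (F.rank i) → MvPolynomial V k)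
    F.ε F.d F.exact_zero F.exact_succ (fun i => ψ i ∘ₗ φ i - LinearMap.id)
    (fun x => by
      have : e (F.ε (ψ 0 (φ 0 x))) = e (F.ε x) := (hψ0 _).trans (hφ0 x)
      simp [e.injective this])
    (fun i x => by simp [hψd, hφd])
  rw [eq_bot_iff]
  rintro _ ⟨_, ⟨⟨f, hf, rfl⟩, hcyc⟩, rfl⟩
  change (F.boundaries i).mkQ ((1 : VarQuotient k V) ⊗ₜ[MvPolynomial V k] f) = 0
  rw [Submodule.mkQ_apply, Submodule.Quotient.mk_eq_zero]
  have hsmall : ∀ x : Fin (F.rank i) → MvPolynomial V k,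
      x ∈ varIdeal k V • (⊤ : Submodule (MvPolynomial V k) (Fin (F.rank i) → MvPolynomial V k)) →
      (1 : VarQuotient k V) ⊗ₜ[MvPolynomial V k] x = 0 := by
    intro x hx
    induction hx using Submodule.smul_induction_on' with
    | smul a ha y _ =>
      rw [← TensorProduct.smul_tmul]
      have : a • (1 : VarQuotient k V) = 0 := by
        rw [← Algebra.algebraMap_eq_smul_one]
        exact Ideal.Quotient.eq_zero_iff_mem.2 ha
      rw [this, TensorProduct.zero_tmul]
    | add x _ y _ hx hy => rw [TensorProduct.tmul_add, hx, hy, add_zero]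
  -- Since `j > r + i`, the element `φ i f` lies beyond the generator degrees of `Y i`, hence in the
  -- ideal of variables times `Y i`; so `ψ i (φ i f)` dies in `k ⊗ F`.
  have hθ : (1 : VarQuotient k V) ⊗ₜ[MvPolynomial V k] (ψ i (φ i f)) = 0 :=
    hsmall _ (Submodule.smul_top_le_comap_smul_top _ (ψ i)
      ((hproj i).small j (by omega) _ (hφ i j f hf)))
  have hb : ∀ y, (1 : VarQuotient k V) ⊗ₜ[MvPolynomial V k] F.d i y ∈ F.boundaries i :=
    fun y => ⟨1 ⊗ₜ y, by simp⟩
  cases i with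
  | zero =>
    have h1 : f = ψ 0 (φ 0 f) - F.d 0 (η 0 f) := by rw [hη0]; simp
    rw [h1, TensorProduct.tmul_sub, hθ, zero_sub]
    exact neg_mem (hb _)
  | succ i =>
    -- After tensoring, the first term vanishes by degree, the last because `f` is a cycle; what
    -- remains is a boundary.
    have h1 : f = ψ (i + 1) (φ (i + 1) f) - F.d (i + 1) (η (i + 1) f) - η i (F.d i f) := by
      rw [sub_sub, hη]; simp
    have h2 : (1 : VarQuotient k V) ⊗ₜ[MvPolynomial V k] F.d i f = 0 := hcyc
    have h3 : (1 : VarQuotient k V) ⊗ₜ[MvPolynomial V k] η i (F.d i f) = 0 := by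
      have := congrArg ((η i).lTensor (VarQuotient k V)) h2
      simpa using this
    rw [h1, TensorProduct.tmul_sub, TensorProduct.tmul_sub, hθ, h3, zero_sub, sub_zero]
    exact neg_mem (hb _)

end GrMod

/-! ### Products of edges and matchings -/

namespace SimpleGraph

variable {V : Type*} (G : SimpleGraph V)

/-- `m` is the exponent vector of a product of `t` edges of `G`. -/
inductive IsEdgeProduct : ℕ → (V →₀ ℕ) → Prop
  | zero : IsEdgeProduct 0 0
  | add {t m a b} : IsEdgeProduct t m → G.Adj a b →
      IsEdgeProduct (t + 1) (m + Finsupp.single a 1 + Finsupp.single b 1)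

variable {G}

theorem IsEdgeProduct.degree_eq {t : ℕ} {m : V →₀ ℕ} (h : G.IsEdgeProduct t m) :
    m.degree = 2 * t := by
  induction h with
  | zero => simp
  | add _ _ ih => simp [ih]; ring

theorem IsEdgeProduct.exists_adj {t : ℕ} {m : V →₀ ℕ} (h : G.IsEdgeProduct t m) {a : V}
    (ha : m a ≠ 0) : ∃ t' b m', t = t' + 1 ∧ G.Adj a b ∧ G.IsEdgeProduct t' m' ∧
      m = m' + Finsupp.single a 1 + Finsupp.single b 1 := by
  classical
  induction h with
  | zero => simp at ha
  | @add t m x y hm hxy ih =>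
    by_cases hax : a = x
    · subst hax
      exact ⟨t, y, m, rfl, hxy, hm, rfl⟩
    by_cases hay : a = y
    · subst hay
      exact ⟨t, x, m, rfl, hxy.symm, hm, add_right_comm _ _ _⟩
    · have : m a ≠ 0 := by
        simpa [Finsupp.single_apply, Ne.symm hax, Ne.symm hay] using ha
      obtain ⟨t', b, m', rfl, hab, hm', rfl⟩ := ih this
      exact ⟨t' + 1, b, m' + Finsupp.single x 1 + Finsupp.single y 1, rfl, hab, hm'.add hxy, by abel⟩

theorem IsEdgeProduct.exists_le_of_le {s t : ℕ} {m : V →₀ ℕ} (h : G.IsEdgeProduct s m)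
    (hts : t ≤ s) : ∃ m', G.IsEdgeProduct t m' ∧ m' ≤ m := by
  induction h with
  | zero =>
    obtain rfl : t = 0 := by omega
    exact ⟨0, .zero, le_rfl⟩
  | @add s m a b hm hab ih =>
    rcases Nat.lt_or_ge s t with hst | hst
    · obtain rfl : t = s + 1 := by omega
      exact ⟨_, hm.add hab, le_rfl⟩
    · obtain ⟨m', h1, h2⟩ := ih hst
      exact ⟨m', h1, h2.trans ((le_add_of_nonneg_right (zero_le)).trans
        (le_add_of_nonneg_right (zero_le)))⟩

/-- If multiplying a product of `t` edges by `f` gives a multiple of a product of `t + 1` edges,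
then two of the factors of `f` suffice for this. -/
theorem IsEdgeProduct.exists_augment {t : ℕ} : ∀ {e f g : V →₀ ℕ}, G.IsEdgeProduct t e →
    G.IsEdgeProduct (t + 1) g → g ≤ e + f → ∃ a b,
      Finsupp.single a 1 + Finsupp.single b 1 ≤ f ∧
        G.IsEdgeProduct (t + 1) (e + Finsupp.single a 1 + Finsupp.single b 1) := by
  classical
  induction t with
  | zero =>
    intro e f g he hg hle
    have he0 : e = 0 := by rw [← Finsupp.degree_eq_zero_iff, he.degree_eq, mul_zero]
    subst he0
    cases hg with
    | @add _ m a b hm hab =>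
      have hm0 : m = 0 := by rw [← Finsupp.degree_eq_zero_iff, hm.degree_eq, mul_zero]
      subst hm0
      exact ⟨a, b, by simpa using hle, hm.add hab⟩
  | succ t ih =>
    intro e f g he hg hle
    -- Otherwise `g ≤ e`, which the degrees `2(t + 2)` and `2(t + 1)` forbid.
    obtain ⟨a, hga, hfa⟩ : ∃ a, g a ≠ 0 ∧ f a ≠ 0 := by
      by_contra! hcon
      have hge : g ≤ e := by
        intro a
        by_cases h : g a = 0
        · simp [h]
        · have := hle a
          simpa [hcon a h] using this
      have := Finsupp.degree_mono hge
      rw [he.degree_eq, hg.degree_eq] at this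
      omega
    obtain ⟨t', z, g', ht', haz, hg', rfl⟩ := hg.exists_adj hga
    obtain rfl : t' = t + 1 := by omega
    -- An alternating path starts at `a` with the edge `az` of `g`. If `z` is available in `f`, the
    -- pair `a, z` works. If not, `z` occurs in `e` and lies on an edge `zy` there; removing `az`
    -- from `g` and `zy` from `e` lets `y` replace `a` in `f`.
    by_cases hfz : f z = 0
    · have hez : e z ≠ 0 := by
        have := hle z
        simp [hfz] at this
        omega
      obtain ⟨t'', y, e', ht'', hzy, he', rfl⟩ := he.exists_adj hez
      obtain rfl : t = t'' := by omega
      obtain ⟨f₀, rfl⟩ : ∃ f₀, f = f₀ + Finsupp.single a 1 :=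
        ⟨f - Finsupp.single a 1, (tsub_add_cancel_of_le (by
          intro v
          rw [Finsupp.single_apply]
          split_ifs with h
          · subst h; omega
          · exact Nat.zero_le _)).symm⟩
      obtain ⟨a', b', hab, hp⟩ := ih (f := f₀ + Finsupp.single y 1) he' hg' (by
        intro v
        have := hle v
        simp only [Finsupp.add_apply] at this ⊢
        omega)
      by_cases hle' : Finsupp.single a' 1 + Finsupp.single b' 1 ≤ f₀
      · refine ⟨a', b', hle'.trans (le_add_of_nonneg_right (zero_le)), ?_⟩
        have := hp.add hzy
        convert this using 1
        abel
      -- If the shorter path uses the new copy of `y`, with other end `c`, then adding `az` gives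
      -- `e' y c * a z = e * a c`, so the ends become `a` and `c`.
      have key : ∀ c, (Finsupp.single y 1 + Finsupp.single c 1 ≤ f₀ + Finsupp.single y 1) →
          G.IsEdgeProduct (t + 1) (e' + Finsupp.single y 1 + Finsupp.single c 1) →
          ∃ a₁ b₁, Finsupp.single a₁ 1 + Finsupp.single b₁ 1 ≤ f₀ + Finsupp.single a 1 ∧
            G.IsEdgeProduct (t + 1 + 1) (e' + Finsupp.single z 1 + Finsupp.single y 1 +
              Finsupp.single a₁ 1 + Finsupp.single b₁ 1) := by
        intro c hc hpc
        refine ⟨a, c, ?_, ?_⟩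
        · rw [add_comm f₀] at hc ⊢
          rw [add_le_add_iff_left] at hc ⊢
          exact hc
        · have := hpc.add haz
          convert this using 1
          abel
      by_cases hay : a' = y
      · subst hay
        exact key b' hab hp
      by_cases hby : b' = y
      · subst hby
        refine key a' (by rwa [add_comm (Finsupp.single b' 1)]) ?_
        rwa [add_right_comm]
      · refine absurd (fun v => ?_) hle'
        have := hab v
        simp only [Finsupp.add_apply, Finsupp.single_apply] at this ⊢
        by_cases hv : y = v
        · subst hv
          simp [hay, hby]
        · simpa [hv] using this
    · refine ⟨a, z, fun v => ?_, he.add haz⟩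
      have hne := haz.ne
      simp only [Finsupp.add_apply, Finsupp.single_apply]
      split_ifs with h1 h2 h2
      · exact absurd (h1.trans h2.symm) hne
      · subst h1; omega
      · subst h2; omega
      · omega

/-- Pairwise disjoint edges `{w, z w}`, `w ∈ P`, form a matching. -/
theorem card_le_matchingNumber [Finite V] (P : Finset V) (z : V → V)
    (hadj : ∀ w ∈ P, G.Adj w (z w)) (hinj : Set.InjOn z P) (hdisj : ∀ w ∈ P, z w ∉ P) :
    P.card ≤ matchingNumber G := by
  classical
  let M : G.Subgraph :=
    { verts := {v | v ∈ P ∨ ∃ w ∈ P, v = z w}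
      Adj := fun u v => (u ∈ P ∧ v = z u) ∨ (v ∈ P ∧ u = z v)
      adj_sub := by
        rintro u v (⟨h, rfl⟩ | ⟨h, rfl⟩)
        · exact hadj _ h
        · exact (hadj _ h).symm
      edge_vert := by
        rintro u v (⟨h, rfl⟩ | ⟨h, rfl⟩)
        · exact Or.inl h
        · exact Or.inr ⟨v, h, rfl⟩
      symm := ⟨fun u v h => h.symm⟩ }
  have hM : M.IsMatching := by
    rintro v (hv | ⟨w, hw, rfl⟩)
    · refine ⟨z v, Or.inl ⟨hv, rfl⟩, ?_⟩
      rintro y (⟨_, h⟩ | ⟨hy, h⟩)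
      · exact h
      · exact absurd hv (h ▸ hdisj y hy)
    · refine ⟨w, Or.inr ⟨hw, rfl⟩, ?_⟩
      rintro y (⟨h, _⟩ | ⟨hy, h⟩)
      · exact absurd h (hdisj w hw)
      · exact (hinj hw hy h).symm
  -- A supremum in `ℕ` is meaningful only for a bounded set; here the number of unordered pairs
  -- bounds it.
  have hbdd : BddAbove {n : ℕ | ∃ M : G.Subgraph, M.IsMatching ∧ M.edgeSet.ncard = n} := by
    refine ⟨Nat.card (Sym2 V), ?_⟩
    rintro n ⟨M, -, rfl⟩
    exact Set.ncard_le_card _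
  refine le_trans ?_ (le_csSup hbdd ⟨M, hM, rfl⟩)
  rw [← Set.ncard_coe_finset]
  refine Set.ncard_le_ncard_of_injOn (fun w => s(w, z w)) (fun w hw => Or.inl ⟨hw, rfl⟩) ?_
    (Set.toFinite _)
  intro w hw w' hw' h
  rcases Sym2.eq_iff.1 h with ⟨h, -⟩ | ⟨h, -⟩
  · exact h
  · exact absurd hw (h ▸ hdisj w' hw')

end SimpleGraph

/-! ### Monomial ideals and splitting along a variable -/

namespace GrMod

open MvPolynomial

variable {k : Type u} [Field k] {V : Type v}

/-- The monomial ideal with set of exponents `U`, with degrees shifted by `d`. -/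
noncomputable def ofExponents (k : Type u) [Field k] {V : Type v} (U : Set (V →₀ ℕ))
    (hU : IsUpperSet U) (d : ℤ) : GrMod k V where
  carrier := restrictSupportIdeal (R := k) U hU
  gr j := (polyPiece k V (j - d)).toAddSubgroup.comap
    (restrictSupportIdeal (R := k) U hU).subtype.toAddMonoidHom
  smul_mem a b p hp x hx := by
    change p * x.1 ∈ polyPiece k V (a + b - d)
    rw [add_sub_assoc]
    exact smul_mem_polyPiece hp hx

theorem mem_restrictSupportIdeal {U : Set (V →₀ ℕ)} {hU : IsUpperSet U} {p : MvPolynomial V k} :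
    p ∈ restrictSupportIdeal (R := k) U hU ↔ ∀ m, coeff m p ≠ 0 → m ∈ U :=
  ⟨fun h _ hm => h (mem_support_iff.2 hm), fun h _ hm => h _ (mem_support_iff.1 hm)⟩

theorem X_mem_polyPiece (w : V) : (X w : MvPolynomial V k) ∈ polyPiece k V 1 := by
  have := monomial_mem_polyPiece (k := k) (Finsupp.single w 1) 1
  rwa [Finsupp.degree_single, Nat.cast_one] at this

/-- The monomial ideal with set of exponents `U` has regularity at most `r`. -/
def RegLE (k : Type u) [Field k] {V : Type v} (U : Set (V →₀ ℕ)) (hU : IsUpperSet U) (r : ℤ) :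
    Prop :=
  ∀ d, ∃ n, HasRes n (ofExponents k U hU d) (r + d)

theorem RegLE.mono {U : Set (V →₀ ℕ)} {hU : IsUpperSet U} {r r' : ℤ} (h : RegLE k U hU r)
    (hr : r ≤ r') : RegLE k U hU r' := fun d =>
  let ⟨n, hn⟩ := h d
  ⟨n, hn.mono (by omega)⟩

theorem regLE_of_empty {U : Set (V →₀ ℕ)} {hU : IsUpperSet U} (h : ∀ f, f ∉ U) (r : ℤ) :
    RegLE k U hU r := fun d => ⟨0, ⟨fun x y => by
  have : ∀ z : restrictSupportIdeal (R := k) U hU, z = 0 := fun z => Subtype.ext <| by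
    ext m
    by_contra hm
    exact h m (mem_restrictSupportIdeal.1 z.2 m (by simpa using hm))
  exact (this x).trans (this y).symm⟩⟩

theorem mem_varIdeal_of_mem_polyPiece {j : ℤ} (hj : 0 < j) {p : MvPolynomial V k}
    (hp : p ∈ polyPiece k V j) : p ∈ varIdeal k V := by
  rw [varIdeal, ← Set.image_univ, mem_ideal_span_X_image]
  intro m hm
  have hdeg := hp m (mem_support_iff.1 hm)
  by_contra! hcon
  have : m = 0 := by
    ext i
    exact hcon i (Set.mem_univ i)
  subst this
  simp at hdeg
  omega

/-- The ideal is the whole ring, free on `1`, which the shift places in degree `d`. -/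
theorem isGradedProjective_ofExponents {U : Set (V →₀ ℕ)} {hU : IsUpperSet U} (h : 0 ∈ U)
    (d : ℤ) : (ofExponents k U hU d).IsGradedProjective d := by
  have htop : restrictSupportIdeal (R := k) U hU = ⊤ :=
    (Ideal.eq_top_iff_one _).2 (mem_restrictSupportIdeal.2 fun m _ => hU (zero_le) h)
  let o : ofExponents k U hU d := (⟨1, htop ▸ trivial⟩ : restrictSupportIdeal (R := k) U hU)
  have ho : ∀ x : restrictSupportIdeal (R := k) U hU, x = x.1 • o := fun x =>
    Subtype.ext (mul_one x.1).symm
  refine ⟨fun B C g hg f hf => ?_, ?_, ?_⟩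
  · obtain ⟨b, hb, hgb⟩ := hg d (f o) (hf d o (by
      change (1 : MvPolynomial V k) ∈ polyPiece k V (d - d)
      simpa using monomial_mem_polyPiece (k := k) (0 : V →₀ ℕ) 1))
    refine ⟨(LinearMap.toSpanSingleton (MvPolynomial V k) B b) ∘ₗ
      (restrictSupportIdeal (R := k) U hU).subtype, fun j x hx => ?_, LinearMap.ext fun x => ?_⟩
    · have := B.smul_mem _ _ _ hx b hb
      rwa [sub_add_cancel] at this
    · change g (x.1 • b) = f x
      rw [map_smul, hgb, ← map_smul]
      exact congrArg f (ho x).symm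
  · exact Module.Projective.of_equiv
      ((LinearEquiv.ofEq _ _ htop).trans Submodule.topEquiv).symm
  · intro j hj x hx
    have h1 : x.1 • o ∈ varIdeal k V • (⊤ : Submodule (MvPolynomial V k) (ofExponents k U hU d)) :=
      Submodule.smul_mem_smul (mem_varIdeal_of_mem_polyPiece (by omega) hx) trivial
    rwa [← ho x] at h1

theorem regLE_of_zero_mem {U : Set (V →₀ ℕ)} {hU : IsUpperSet U} (h : 0 ∈ U) {r : ℤ}
    (hr : 0 ≤ r) : RegLE k U hU r := fun d =>
  ⟨1, (isGradedProjective_ofExponents h d).hasRes.mono (by omega)⟩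

/-- Division with remainder by `X w`: the remainder collects the monomials free of `w`, and both
parts inherit homogeneity. -/
theorem exists_eq_X_mul_add {U A D : Set (V →₀ ℕ)} {hU : IsUpperSet U} {hA : IsUpperSet A}
    {hD : IsUpperSet D} (w : V) (hUA : ∀ f, f + Finsupp.single w 1 ∈ U → f ∈ A)
    (hUD : ∀ f, f.erase w ∈ U → f ∈ D) {q : MvPolynomial V k}
    (hq : q ∈ restrictSupportIdeal (R := k) U hU) :
    ∃ b ∈ restrictSupportIdeal (R := k) A hA, ∃ c ∈ restrictSupportIdeal (R := k) D hD,
      X w * b + c = q ∧ ∀ j, q ∈ polyPiece k V j →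
        b ∈ polyPiece k V (j - 1) ∧ c ∈ polyPiece k V j := by
  rw [mem_restrictSupportIdeal] at hq
  have hc : ∀ m, coeff m (modMonomial q (Finsupp.single w 1)) ≠ 0 →
      m w = 0 ∧ coeff m q ≠ 0 := by
    intro m hm
    by_cases hwm : Finsupp.single w 1 ≤ m
    · exact absurd (coeff_modMonomial_of_le _ hwm) hm
    · rw [coeff_modMonomial_of_not_le _ hwm] at hm
      rw [Finsupp.single_le_iff] at hwm
      exact ⟨by omega, hm⟩
  refine ⟨divMonomial q (Finsupp.single w 1), mem_restrictSupportIdeal.2 fun m hm => ?_,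
    modMonomial q (Finsupp.single w 1), mem_restrictSupportIdeal.2 fun m hm => ?_,
    divMonomial_add_modMonomial_single q w, fun j hj => ⟨fun m hm => ?_,
    fun m hm => hj m (hc m hm).2⟩⟩
  · rw [coeff_divMonomial, add_comm] at hm
    exact hUA m (hq _ hm)
  · obtain ⟨h1, h2⟩ := hc m hm
    refine hUD m ?_
    rw [Finsupp.erase_of_notMem_support (by simpa using h1)]
    exact hq m h2
  · rw [coeff_divMonomial] at hm
    have := hj _ hm
    rw [map_add, Finsupp.degree_single] at this
    push_cast at this
    omega

/-- Splitting a monomial ideal along a variable: `J = X w * (J : X w) + J'`, where `J'` is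
generated by the monomials of `J` not involving `X w`. -/
theorem RegLE.of_variable {U A D : Set (V →₀ ℕ)} {hU : IsUpperSet U} {hA : IsUpperSet A}
    {hD : IsUpperSet D} (w : V) (hUA : ∀ f, f ∈ A ↔ f + Finsupp.single w 1 ∈ U)
    (hUD : ∀ f, f ∈ D ↔ f.erase w ∈ U) {r : ℤ} (h1 : RegLE k A hA (r - 1))
    (h2 : RegLE k D hD r) : RegLE k U hU r := by
  classical
  have herase : ∀ f : V →₀ ℕ, f.erase w ≤ f := fun f v => by
    rw [Finsupp.erase_apply]; split_ifs <;> simp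
  have hDU : D ⊆ U := fun f hf => hU (herase f) ((hUD f).1 hf)
  have hDA : D ⊆ A := fun f hf => (hUA f).2 (hU (le_add_of_nonneg_right zero_le) (hDU hf))
  have hDw : ∀ f, f + Finsupp.single w 1 ∈ D → f ∈ D := fun f hf => by
    rw [hUD] at hf ⊢
    simpa [Finsupp.erase_add] using hf
  have hX : ∀ p ∈ restrictSupportIdeal (R := k) A hA,
      X w * p ∈ restrictSupportIdeal (R := k) U hU := by
    intro p hp
    rw [mem_restrictSupportIdeal] at hp ⊢
    intro m hm
    rw [mul_comm, coeff_mul_X'] at hm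
    split_ifs at hm with hw
    · have := (hUA _).1 (hp _ hm)
      rwa [tsub_add_cancel_of_le] at this
      rw [Finsupp.single_le_iff]
      exact Nat.one_le_iff_ne_zero.2 (Finsupp.mem_support_iff.1 hw)
    · exact absurd rfl hm
  have hle1 : restrictSupportIdeal (R := k) D hD ≤ restrictSupportIdeal (R := k) A hA :=
    restrictSupport_mono _ hDA
  have hle2 : restrictSupportIdeal (R := k) D hD ≤ restrictSupportIdeal (R := k) U hU :=
    restrictSupport_mono _ hDU
  intro d
  -- If `X w * b + c = 0` with `c` in `D`, then `b` is in `D` too, since membership in `D` ignores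
  -- the exponent of `w`. So the kernel of `p` is a copy of `D`, shifted by one; `of_quotient`
  -- allows exactly this extra degree.
  let i : ofExponents k D hD (d + 1) →ₗ[MvPolynomial V k]
      (ofExponents k A hA (d + 1)).prod (ofExponents k D hD d) :=
    (Submodule.inclusion hle1).prod (-(LinearMap.lsmul _ (restrictSupportIdeal (R := k) D hD) (X w)))
  let p : (ofExponents k A hA (d + 1)).prod (ofExponents k D hD d) →ₗ[MvPolynomial V k]
      ofExponents k U hU d :=
    (((LinearMap.lsmul _ (MvPolynomial V k) (X w)).restrict hX).coprod (Submodule.inclusion hle2))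
  have honto : ∀ q : restrictSupportIdeal (R := k) U hU,
      ∃ (b : restrictSupportIdeal (R := k) A hA) (c : restrictSupportIdeal (R := k) D hD),
        p (b, c) = q ∧ ∀ j, q.1 ∈ polyPiece k V j →
          b.1 ∈ polyPiece k V (j - 1) ∧ c.1 ∈ polyPiece k V j := by
    intro q
    obtain ⟨b, hb, c, hc, hbc, hj⟩ := exists_eq_X_mul_add (hA := hA) (hD := hD) w
      (fun f => (hUA f).2) (fun f => (hUD f).2) q.2
    exact ⟨⟨b, hb⟩, ⟨c, hc⟩, Subtype.ext hbc, hj⟩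
  have hS : IsShortExact i p := by
    refine ⟨?_, ?_, ?_, ?_, ?_, ?_⟩
    · intro a b hab
      exact Subtype.ext (congrArg (fun z : restrictSupportIdeal (R := k) A hA ×
        restrictSupportIdeal (R := k) D hD => z.1.1) hab)
    · rintro ⟨b, c⟩
      constructor
      · intro h
        have h0 : X w * b.1 + c.1 = 0 := congrArg Subtype.val h
        have hb : b.1 ∈ restrictSupportIdeal (R := k) D hD := by
          refine mem_restrictSupportIdeal.2 fun m hm => hDw m ?_
          refine mem_restrictSupportIdeal.1 c.2 _ ?_
          rw [← neg_eq_iff_add_eq_zero] at h0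
          rw [← h0, coeff_neg, mul_comm, coeff_mul_X, neg_ne_zero]
          exact hm
        exact ⟨⟨b.1, hb⟩, Prod.ext (Subtype.ext rfl)
          (Subtype.ext (neg_eq_iff_add_eq_zero.2 h0))⟩
      · rintro ⟨a, ha⟩
        rw [← ha]
        refine Subtype.ext ?_
        exact add_neg_cancel (X w * a.1)
    · intro q
      obtain ⟨b, c, h, -⟩ := honto q
      exact ⟨(b, c), h⟩
    · intro j a
      refine ⟨fun h => h.1, fun h => ⟨h, ?_⟩⟩
      change -(X w * a.1) ∈ polyPiece k V (j - d)
      have h' : a.1 ∈ polyPiece k V (j - (d + 1)) := h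
      have := smul_mem_polyPiece (X_mem_polyPiece w) h'
      rw [show 1 + (j - (d + 1)) = j - d by ring] at this
      exact neg_mem this
    · intro j z hz
      change X w * z.1.1 + z.2.1 ∈ polyPiece k V (j - d)
      have h' : z.1.1 ∈ polyPiece k V (j - (d + 1)) := hz.1
      have := smul_mem_polyPiece (X_mem_polyPiece w) h'
      rw [show 1 + (j - (d + 1)) = j - d by ring] at this
      exact add_mem this hz.2
    · intro j q hq
      obtain ⟨b, c, h, hbc⟩ := honto q
      refine ⟨(b, c), ⟨?_, (hbc _ hq).2⟩, h⟩
      change b.1 ∈ polyPiece k V (j - (d + 1))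
      rw [← sub_sub]
      exact (hbc _ hq).1
  obtain ⟨n₁, hn₁⟩ := h1 (d + 1)
  obtain ⟨n₂, hn₂⟩ := h2 d
  obtain ⟨n₃, hn₃⟩ := h2 (d + 1)
  let N := max n₁ (max n₂ n₃)
  refine ⟨N + 1, HasRes.of_quotient hS ((hn₃.mono (by omega)).mono_length (by omega))
    (HasRes.of_extension (isShortExact_prod _ _) ((hn₁.mono (by omega)).mono_length ?_)
      (hn₂.mono_length ?_))⟩ <;> omega

end GrMod

/-! ### Colon ideals of powers of the edge ideal -/

namespace SimpleGraph

variable {V : Type v} (G : SimpleGraph V)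

/-- The exponents `f` such that the part of `f` supported in `W`, multiplied by `m`, is divisible
by a product of `s` edges. -/
def colonExponents [DecidableEq V] (s : ℕ) (W : Finset V) (m : V →₀ ℕ) : Set (V →₀ ℕ) :=
  {f | ∃ g, G.IsEdgeProduct s g ∧ g ≤ m + f.filter (· ∈ W)}

variable {G}

theorem isUpperSet_colonExponents [DecidableEq V] (s : ℕ) (W : Finset V) (m : V →₀ ℕ) :
    IsUpperSet (G.colonExponents s W m) := by
  rintro f f' hff' ⟨g, hg, hle⟩
  refine ⟨g, hg, hle.trans (add_le_add_right (fun v => ?_) m)⟩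
  by_cases hv : v ∈ W
  · simpa [hv] using hff' v
  · simp [hv]

theorem add_single_mem_colonExponents [DecidableEq V] {s : ℕ} {W : Finset V} {m : V →₀ ℕ} {w : V}
    (hw : w ∈ W) (f : V →₀ ℕ) : f ∈ G.colonExponents s W (m + Finsupp.single w 1) ↔
      f + Finsupp.single w 1 ∈ G.colonExponents s W m := by
  simp only [colonExponents, Set.mem_ofPred_eq, Finsupp.filter_add,
    Finsupp.filter_single_of_pos (· ∈ W) hw]
  rw [add_assoc, add_comm (Finsupp.single w 1)]

theorem erase_mem_colonExponents [DecidableEq V] {s : ℕ} {W : Finset V} {m : V →₀ ℕ} (w : V)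
    (f : V →₀ ℕ) : f ∈ G.colonExponents s (W.erase w) m ↔
      f.erase w ∈ G.colonExponents s W m := by
  have : f.filter (· ∈ W.erase w) = (f.erase w).filter (· ∈ W) := by
    ext v
    by_cases h1 : v = w <;> by_cases h2 : v ∈ W <;>
      simp [Finsupp.filter_apply, h1, h2]
  simp only [colonExponents, Set.mem_ofPred_eq, this]

theorem sum_single_apply [DecidableEq V] (P : Finset V) (v : V) :
    (∑ w ∈ P, Finsupp.single w 1 : V →₀ ℕ) v = if v ∈ P then 1 else 0 := by
  simp [Finsupp.finsetSum_apply, Finsupp.single_apply]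

theorem sum_single_eq_add [DecidableEq V] {P : Finset V} {a : V} (ha : a ∈ P) :
    (∑ w ∈ P, Finsupp.single w 1 : V →₀ ℕ) =
      Finsupp.single a 1 + ∑ w ∈ P.erase a, Finsupp.single w 1 :=
  (Finset.add_sum_erase P _ ha).symm

/-- Colons of `I(G) ^ s` by a product of `t` edges and of the vertices of `P`, where `P` is matched
into its complement. -/
theorem regLE_colonExponents (k : Type u) [Field k] [Finite V] [DecidableEq V] (s N : ℕ) :
    ∀ (W P : Finset V) (z : V → V) (e : V →₀ ℕ) (t : ℕ), G.IsEdgeProduct t e → t ≤ s →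
      (∀ w ∈ P, G.Adj w (z w)) → Set.InjOn z P → (∀ w ∈ P, z w ∉ P) →
      2 * t + P.card + 1 ≤ 2 * s + matchingNumber G →
      W.card + 3 * (s - t) + (matchingNumber G - P.card) ≤ N →
      GrMod.RegLE k (G.colonExponents s W (e + ∑ w ∈ P, Finsupp.single w 1))
        (isUpperSet_colonExponents s W _)
        (2 * s + matchingNumber G - 1 - (2 * t + P.card)) := by
  -- The weight 3 pays for an edge that absorbs two elements of `P`: then `s - t` drops by 1 while
  -- `β - |P|` rises by 2. The hypothesis on `2 * t + P.card + 1` keeps the claimed bound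
  -- nonnegative, as needed once the ideal is the whole ring.
  induction N using Nat.strong_induction_on with
  | _ N ih =>
  intro W P z e t he hts hadj hinj hdisj hr hN
  have hβ := card_le_matchingNumber P z hadj hinj hdisj
  rcases hts.eq_or_lt with heq | hts
  · have h0 : 0 ∈ G.colonExponents s W (e + ∑ w ∈ P, Finsupp.single w 1) :=
      ⟨e, heq ▸ he, (le_add_of_nonneg_right zero_le).trans (le_add_of_nonneg_right zero_le)⟩
    exact GrMod.regLE_of_zero_mem h0 (by omega)
  have hdel : ∀ w ∈ W, GrMod.RegLE k
      (G.colonExponents s (W.erase w) (e + ∑ w ∈ P, Finsupp.single w 1))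
      (isUpperSet_colonExponents s _ _)
      (2 * s + matchingNumber G - 1 - (2 * t + P.card)) := by
    intro w hw
    have := Finset.card_erase_lt_of_mem hw
    exact ih _ (by omega) (W.erase w) P z e t he hts.le hadj hinj hdisj hr le_rfl
  -- Two elements of `P` are absorbed into `e`: the ideal and `2t + |P|` stay the same.
  by_cases hPP : ∃ a ∈ P, ∃ b ∈ P, a ≠ b ∧
      G.IsEdgeProduct (t + 1) (e + Finsupp.single a 1 + Finsupp.single b 1)
  · obtain ⟨a, ha, b, hb, hab, hp⟩ := hPP
    have hb' : b ∈ P.erase a := Finset.mem_erase.2 ⟨hab.symm, hb⟩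
    have hsub : (P.erase a).erase b ⊆ P :=
      (Finset.erase_subset _ _).trans (Finset.erase_subset _ _)
    have hc1 := Finset.card_erase_add_one ha
    have hc2 := Finset.card_erase_add_one hb'
    have := ih _ (by omega) W ((P.erase a).erase b) z _ (t + 1) hp hts
      (fun w hw => hadj w (hsub hw)) (hinj.mono hsub)
      (fun w hw h => hdisj w (hsub hw) (hsub h)) (by omega) le_rfl
    have heq : e + ∑ w ∈ P, Finsupp.single w 1 = e + Finsupp.single a 1 + Finsupp.single b 1 +
        ∑ w ∈ (P.erase a).erase b, Finsupp.single w 1 := by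
      rw [sum_single_eq_add ha, sum_single_eq_add hb']
      abel
    simp only [heq]
    exact this.mono (by omega)
  -- Split along `y`: in the colon, `a` leaves `P` and `ay` joins `e`, so `2t + |P|` grows by one.
  by_cases hPW : ∃ a ∈ P, ∃ y ∈ W,
      G.IsEdgeProduct (t + 1) (e + Finsupp.single a 1 + Finsupp.single y 1)
  · obtain ⟨a, ha, y, hy, hp⟩ := hPW
    have hsub : P.erase a ⊆ P := Finset.erase_subset _ _
    have hc := Finset.card_erase_add_one ha
    have := ih _ (by omega) W (P.erase a) z _ (t + 1) hp hts
      (fun w hw => hadj w (hsub hw)) (hinj.mono hsub)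
      (fun w hw h => hdisj w (hsub hw) (hsub h)) (by omega) le_rfl
    have heq : e + ∑ w ∈ P, Finsupp.single w 1 + Finsupp.single y 1 =
        e + Finsupp.single a 1 + Finsupp.single y 1 + ∑ w ∈ P.erase a, Finsupp.single w 1 := by
      rw [sum_single_eq_add ha]
      abel
    simp only [← heq] at this
    exact GrMod.RegLE.of_variable y (add_single_mem_colonExponents hy)
      (erase_mem_colonExponents y) (this.mono (by omega)) (hdel y hy)
  by_cases hWW : ∃ w ∈ W, ∃ y ∈ W,
      G.IsEdgeProduct (t + 1) (e + Finsupp.single w 1 + Finsupp.single y 1)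
  · obtain ⟨w, hw, y, hy, hp⟩ := hWW
    have hwP : w ∉ P := fun h => hPW ⟨w, h, y, hy, hp⟩
    -- The neighbour `x` of `w` in a factorization of `e * w y` into edges serves as the new partner
    -- of `w`. Any clash of `w` or `x` with `P` or its partners would produce a product excluded by
    -- `hPW`.
    obtain ⟨t', x, g, ht', hwx, hg, heg⟩ := hp.exists_adj (a := w) (by simp)
    obtain rfl : t = t' := by omega
    have hgx : g + Finsupp.single x 1 = e + Finsupp.single y 1 := by
      apply add_right_cancel (b := Finsupp.single w 1)
      rw [add_right_comm, ← heg]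
      abel
    have hxP : x ∉ P := fun h => hPW ⟨x, h, w, hw, he.add hwx.symm⟩
    have hzx : ∀ a ∈ P, z a ≠ x := by
      rintro a ha rfl
      refine hPW ⟨a, ha, y, hy, ?_⟩
      rw [add_right_comm, ← hgx]
      exact hg.add (hadj a ha).symm
    have hzw : ∀ a ∈ P, z a ≠ w := by
      rintro a ha rfl
      exact hPW ⟨a, ha, _, hw, he.add (hadj a ha)⟩
    have hne : ∀ a ∈ P, a ≠ w := fun a ha h => hwP (h ▸ ha)
    have hadj' : ∀ a ∈ insert w P, G.Adj a (Function.update z w x a) := by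
      intro a ha
      rcases Finset.mem_insert.1 ha with rfl | ha
      · simpa using hwx
      · rw [Function.update_of_ne (hne a ha)]
        exact hadj a ha
    have hinj' : Set.InjOn (Function.update z w x) (insert w P : Finset V) := by
      intro a ha b hb hab
      rcases Finset.mem_insert.1 ha with rfl | ha' <;> rcases Finset.mem_insert.1 hb with rfl | hb'
      · rfl
      · rw [Function.update_self, Function.update_of_ne (hne b hb')] at hab
        exact absurd hab.symm (hzx b hb')
      · rw [Function.update_self, Function.update_of_ne (hne a ha')] at hab
        exact absurd hab (hzx a ha')
      · rw [Function.update_of_ne (hne a ha'), Function.update_of_ne (hne b hb')] at hab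
        exact hinj ha' hb' hab
    have hdisj' : ∀ a ∈ insert w P, Function.update z w x a ∉ insert w P := by
      intro a ha
      rw [Finset.mem_insert, not_or]
      rcases Finset.mem_insert.1 ha with rfl | ha
      · rw [Function.update_self]
        exact ⟨hwx.ne', hxP⟩
      · rw [Function.update_of_ne (hne a ha)]
        exact ⟨hzw a ha, hdisj a ha⟩
    have hβ' := card_le_matchingNumber _ _ hadj' hinj' hdisj'
    have hc := Finset.card_insert_of_notMem hwP
    have := ih _ (by omega) W (insert w P) _ e t he hts.le hadj' hinj' hdisj' (by omega) le_rfl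
    have heq : e + ∑ w ∈ insert w P, Finsupp.single w 1 =
        e + ∑ w ∈ P, Finsupp.single w 1 + Finsupp.single w 1 := by
      rw [Finset.sum_insert hwP]
      abel
    simp only [heq] at this
    exact GrMod.RegLE.of_variable w (add_single_mem_colonExponents hw)
      (erase_mem_colonExponents w) (this.mono (by omega)) (hdel w hw)
  -- No move is left. A monomial of the ideal would, by augmentation, yield `a, b` among the factors
  -- of `x_P` and of the part in `W` that extend `e` to `t + 1` edges, which is one of the excluded
  -- cases.
  refine GrMod.regLE_of_empty ?_ _
  rintro f ⟨g, hg, hle⟩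
  obtain ⟨g', hg', hle'⟩ := hg.exists_le_of_le (t := t + 1) hts
  rw [add_assoc] at hle
  obtain ⟨a, b, hab, hp⟩ := he.exists_augment hg' (hle'.trans hle)
  have hmem : ∀ v, v ∉ P → (Finsupp.single a 1 + Finsupp.single b 1 : V →₀ ℕ) v ≠ 0 → v ∈ W := by
    intro v hv h
    by_contra hvW
    have := hab v
    rw [Finsupp.add_apply (∑ w ∈ P, Finsupp.single w 1), sum_single_apply, if_neg hv,
      Finsupp.filter_apply_neg _ _ hvW] at this
    omega
  -- Each vertex occurs at most once in `x_P`, so a repeated factor `a = b` must also come from `W`.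
  have hmem2 : ∀ v, 2 ≤ (Finsupp.single a 1 + Finsupp.single b 1 : V →₀ ℕ) v → v ∈ W := by
    intro v h
    by_contra hvW
    have := hab v
    rw [Finsupp.add_apply (∑ w ∈ P, Finsupp.single w 1), sum_single_apply,
      Finsupp.filter_apply_neg _ _ hvW] at this
    split_ifs at this <;> omega
  by_cases ha : a ∈ P <;> by_cases hb : b ∈ P
  · by_cases h : a = b
    · subst h
      exact hPW ⟨a, ha, a, hmem2 a (by simp), hp⟩
    · exact hPP ⟨a, ha, b, hb, h, hp⟩
  · exact hPW ⟨a, ha, b, hmem b hb (by simp), hp⟩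
  · exact hPW ⟨b, hb, a, hmem a ha (by simp), by rwa [add_right_comm]⟩
  · exact hWW ⟨a, hmem a ha (by simp), b, hmem b hb (by simp), hp⟩

theorem edgeIdeal_pow_eq_span (k : Type u) [Field k] (s : ℕ) :
    edgeIdeal k G ^ s =
      Ideal.span ((fun m => MvPolynomial.monomial m (1 : k)) '' {m | G.IsEdgeProduct s m}) := by
  induction s with
  | zero =>
    rw [pow_zero, Ideal.one_eq_top, eq_comm, Ideal.eq_top_iff_one]
    exact Ideal.subset_span ⟨0, .zero, rfl⟩
  | succ s ih =>
    rw [pow_succ, ih, edgeIdeal, Ideal.span_mul_span']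
    congr 1
    have hX : ∀ m (a b : V), MvPolynomial.monomial m (1 : k) *
        (MvPolynomial.X a * MvPolynomial.X b) =
          MvPolynomial.monomial (m + Finsupp.single a 1 + Finsupp.single b 1) 1 := by
      intro m a b
      rw [MvPolynomial.X, MvPolynomial.X, MvPolynomial.monomial_mul, MvPolynomial.monomial_mul,
        add_assoc, mul_one, mul_one]
    ext p
    constructor
    · rintro ⟨_, ⟨m, hm, rfl⟩, _, ⟨a, b, hab, rfl⟩, rfl⟩
      exact ⟨_, hm.add hab, (hX m a b).symm⟩
    · rintro ⟨_, hm, rfl⟩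
      obtain _ | @⟨_, m, a, b, hm, hab⟩ := hm
      exact ⟨_, ⟨m, hm, rfl⟩, _, ⟨a, b, hab, rfl⟩, hX m a b⟩

theorem edgeIdeal_pow_eq_restrictSupportIdeal (k : Type u) [Field k] [Fintype V] [DecidableEq V]
    (s : ℕ) : edgeIdeal k G ^ s = MvPolynomial.restrictSupportIdeal (R := k)
      (G.colonExponents s Finset.univ 0) (isUpperSet_colonExponents s _ _) := by
  rw [edgeIdeal_pow_eq_span]
  ext p
  rw [MvPolynomial.mem_ideal_span_monomial_image, GrMod.mem_restrictSupportIdeal]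
  have : ∀ m : V →₀ ℕ, m.filter (· ∈ Finset.univ) = m := fun m =>
    (Finsupp.filter_eq_self_iff _ _).2 fun x _ => Finset.mem_univ x
  simp only [colonExponents, this, zero_add, MvPolynomial.mem_support_iff, Set.mem_ofPred_eq]

end SimpleGraph

theorem theorem3p3 {k : Type*} [Field k] {V : Type*} [Fintype V] (G : SimpleGraph V)
    (s : ℕ) (hs : 1 ≤ s) :
    idealRegularity (edgeIdeal k G ^ s) ≤
      (((2 * (s : ℤ) + (matchingNumber G : ℤ) - 1 : ℤ) : ℝ) : EReal) := by
  classical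
  -- With `t = 0` and `P = ∅`, nonnegativity of the bound reads `1 ≤ 2s + β`, where `s ≥ 1` enters.
  have h := SimpleGraph.regLE_colonExponents (G := G) k s _ Finset.univ ∅ id 0 0 .zero s.zero_le
    (by simp) (by simp) (by simp) (by simp; omega) le_rfl
  obtain ⟨n, hn⟩ := h 0
  simp only [Finset.sum_empty, add_zero, Finset.card_empty, Nat.cast_zero, mul_zero,
    sub_zero] at hn
  rw [SimpleGraph.edgeIdeal_pow_eq_restrictSupportIdeal]
  refine hn.regularity_le _ (LinearEquiv.refl _ _) fun j x hx => ?_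
  change x.1 ∈ polyPiece k V (j - 0)
  rw [sub_zero]
  exact hx
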